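/- Let $\mathbb{S}^2=\{x\in\mathbb{R}^3:\|x\|=1\}$, with spherical distance $d_s(x,y)=\arccos\langle x,y\rangle$. A set $K\subset\mathbb{S}^2$ is \emph{spherically convex} if it is contained in an open hemisphere $\{x: d_s(u,x)<\frac{\pi}{2}\}$ and contains, with any two of its points $x,y$, the shorter great-circle arc between $x$ and $y$. A \emph{spherical convex body} is a compact, spherically convex set with nonempty interior in $\mathbb{S}^2$. The \emph{perimeter} $\operatorname{perim}(K)$ is the length (one-dimensional Hausdorff measure) of the boundary of $K$ in $\mathbb{S}^2$. Let $S$ be the open hemisphere with center $c\in\mathbb{S}^2$, let $\bar L,\bar H$ be great circles meeting orthogonally at $c$, and let $L=\bar L\cap S$, $H=\bar H\cap S$. Choose Cartesian coordinates in which $c=(1,0,0)$, $\bar L$ lies in the $(x,y)$-plane and $\bar H$ lies in the $(x,z)$-plane, and write each point $p\in S$ as $$p=(\cos\theta_p\cos\varphi_p,\ \cos\theta_p\sin\varphi_p,\ \sin\theta_p),\qquad -\tfrac{\pi}{2}<\theta_p,\varphi_p<\tfrac{\pi}{2}.$$ For $-\frac{\pi}{2}<\theta<\frac{\pi}{2}$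 let $C_\theta=\{p\in S:\theta_p=\theta\}$ be the \emph{distance curves} with axis $L$. The \emph{angular length} of an arc of $C_\theta$ with endpoints $p,q$ is $|\varphi_p-\varphi_q|$; the angular length of a singleton and of the empty set is $0$. A compact set $X\subset S$ has the \emph{connectedness property} if $X\cap C_\theta$ is connected (possibly empty) for every $\theta$. Its \emph{Steiner symmetral} $\sigma_{L,H}(X)\subset S$ is then defined as follows: for each $\theta$, if $X\cap C_\theta=\emptyset$, then $\sigma_{L,H}(X)\cap C_\theta=\emptyset$; if $X\cap C_\theta$ is a singleton, then $\sigma_{L,H}(X)\cap C_\theta=C_\theta\cap H$; and if $X\cap C_\theta$ is a closed arc, then $\sigma_{L,H}(X)\cap C_\theta$ is the closed arc of $C_\theta$ of the same length centered at $C_\theta\cap H$. A spherical convex body $K\subset S$ with the connectedness property has the \emph{angular monotonicity property} if the angular length of $K\cap C_\theta$ is nonincreasing in $\theta$ for $\theta\ge 0$ and nondecreasing in $\theta$ for $\theta\le 0$. \textbf{Theorem.} If $K\subset S$ is a spherical convex body with the angular monotonicity property, then $$\operatorname{perim}(\sigma_{L,H}(K))\le\operatorname{perim}(K).$$ -/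

import Mathlib

open Set Metric MeasureTheory
open scoped Real

noncomputable section

namespace SphSteiner

/-- Euclidean three-space. -/
abbrev E3 : Type := EuclideanSpace ℝ (Fin 3)

/-- The unit sphere `𝕊²`, with the topology (and the chordal metric) inherited from `ℝ³`. -/
abbrev Sph2 : Type := sphere (0 : E3) 1

/-- The spherical distance `arccos ⟨x, y⟩`. -/
def sdist (x y : E3) : ℝ := Real.arccos (inner ℝ x y)

/-- The open hemisphere with center `u`. -/
def openHemisphere (u : E3) : Set Sph2 := {p | sdist u p < π / 2}

/-- The spherical segment `[x, y]_s`: for distinct nonantipodal `x, y`, the points of the sphere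
that are combinations of `x` and `y` with nonnegative coefficients form the shorter of the two arcs
into which `x, y` cut their great circle; for `x = y` this set is `{x}`. -/
def sphSegment (x y : Sph2) : Set Sph2 :=
  {z | ∃ s t : ℝ, 0 ≤ s ∧ 0 ≤ t ∧ (z : E3) = s • (x : E3) + t • (y : E3)}

/-- Spherical convexity: contained in some open hemisphere, and closed under segments. -/
def SphConvex (K : Set Sph2) : Prop :=
  (∃ u : Sph2, K ⊆ openHemisphere u) ∧ ∀ x ∈ K, ∀ y ∈ K, sphSegment x y ⊆ K

/-- Spherical convex bodies: compact, spherically convex, with nonempty interior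
(relative to `𝕊²`). -/
structure IsSphConvexBody (K : Set Sph2) : Prop where
  isCompact : IsCompact K
  convex : SphConvex K
  interior_nonempty : (interior K).Nonempty

/-- The perimeter of a subset of `𝕊²`: the one-dimensional Hausdorff measure (arclength) of its
boundary relative to `𝕊²`. -/
def perim (K : Set Sph2) : ENNReal := Measure.hausdorffMeasure 1 (frontier K)

/-! An orthonormal basis `b = (b 0, b 1, b 2)` of `ℝ³` encodes the symmetrization data: the
center `c = b 0` of the open hemisphere `S`, the line `L`, the part in `S` of the great circle
spanned by `b 0, b 1`, and the line `H`, the part in `S` of the great circle spanned by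
`b 0, b 2`. These great circles meet orthogonally at `c`. The poles are `± b 2`. -/

variable (b : OrthonormalBasis (Fin 3) ℝ E3)

/-- The open hemisphere `S` with center `c = b 0`. -/
def hemi : Set Sph2 := openHemisphere (b 0)

/-- The coordinate `θ_p`: the signed spherical distance of `p` from `L`. -/
def lat (p : Sph2) : ℝ := Real.arcsin (inner ℝ (b 2) (p : E3))

/-- The coordinate `φ_p` of a point `p ∈ S` (so that `⟨b 0, p⟩ > 0`): the signed spherical distance
from `H` of the orthogonal projection of `p` onto `L`. Thus, with respect to `b`,
`p = (cos θ_p cos φ_p, cos θ_p sin φ_p, sin θ_p)`. -/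
def lon (p : Sph2) : ℝ :=
  Real.arctan (inner ℝ (b 1) (p : E3) / inner ℝ (b 0) (p : E3))

/-- The distance curve `C_θ` with axis `L`. -/
def distCurve (θ : ℝ) : Set Sph2 := {p | p ∈ hemi b ∧ lat b p = θ}

/-- The connectedness property: each distance curve with axis `L` meets `X` in a connected
(possibly empty) set. -/
def ConnectednessProperty (X : Set Sph2) : Prop :=
  ∀ θ ∈ Ioo (-(π / 2)) (π / 2), IsPreconnected (X ∩ distCurve b θ)

/-- The angular length of an arc `A` of a distance curve: the length `|φ_p - φ_q|` of the interval
of `φ`-coordinates of its points, where `p, q` are the endpoints of `A`. It is `0` if `A` is a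
singleton or empty. -/
def angLength (A : Set Sph2) : ℝ := diam (lon b '' A)

/-- The angular length of `K ∩ C_θ` is nonincreasing for `θ ≥ 0` and nondecreasing for `θ ≤ 0`. -/
def AngularMonotone (K : Set Sph2) : Prop :=
  AntitoneOn (fun θ => angLength b (K ∩ distCurve b θ)) (Ico 0 (π / 2)) ∧
    MonotoneOn (fun θ => angLength b (K ∩ distCurve b θ)) (Ioc (-(π / 2)) 0)

/-- The Steiner symmetral `σ_{L,H}(X)` (of a compact `X ⊆ S` with the connectedness property).
Each distance curve `C` meets it in the empty set if `X ∩ C = ∅`, and otherwise in the closed arc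
of `C` centered at `C ∩ H` with the same angular length as `X ∩ C`, hence with the same length;
this arc is the point `C ∩ H` if `X ∩ C` is a singleton. -/
def symmetral (X : Set Sph2) : Set Sph2 :=
  {p | p ∈ hemi b ∧ (X ∩ distCurve b (lat b p)).Nonempty ∧
    |lon b p| ≤ angLength b (X ∩ distCurve b (lat b p)) / 2}

end SphSteiner

end

/-! Cut the sphere along the axis `L`. Let `T > 0` be the greatest latitude in `K`, and let `f =
east b K`, `g = west b K` be the extreme longitudes at each latitude in `[0, T]`. North of `L` the
frontier of `K` contains the graphs of `f` and `g`, while the frontier of the symmetral lies on the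
graphs of `±(f - g)/2`. The length element is `√(dθ² + cos²θ dφ²)`, a norm at each fixed latitude.
By the triangle inequality (`two_mul_sqrt_le`) the two symmetrized chords over a short latitude
interval are, to leading order, together no longer than the two original ones.

No derivatives are needed. The measure of a curve is bounded below by its chords
(`edist_le_hausdorffMeasure_image_Ioo`) and above by coverings. The covering bound is sharp because
the half-width is monotone: a piece of its graph has diameter controlled by the coordinate
increments between its ends (`ediam_graph_le`). The two bounds differ by a factor `κ²`, and `κ → 1`
gives `hausdorffMeasure_graphPair_half_sub_le`.

Angular monotonicity, with convexity and compactness, also makes `f` and `g` continuous. The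
southern part is the northern part for the basis `mirror b`. The equator is treated separately,
since a body lying on one side of `L` may have a boundary arc there. -/

noncomputable section

namespace SphSteiner

/-! ### Latitude, longitude and the chordal metric -/

section Coordinates

variable (b : OrthonormalBasis (Fin 3) ℝ E3)

theorem inner_basis (i j : Fin 3) : inner ℝ (b i) (b j) = if i = j then (1 : ℝ) else 0 :=
  orthonormal_iff_ite.mp b.orthonormal i j

theorem sum_sq_inner (x : E3) :
    inner ℝ (b 0) x ^ 2 + inner ℝ (b 1) x ^ 2 + inner ℝ (b 2) x ^ 2 = ‖x‖ ^ 2 := by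
  have h := b.sum_sq_norm_inner_right x
  simpa [Fin.sum_univ_three] using h

theorem sum_sq_inner_eq_one (p : Sph2) :
    inner ℝ (b 0) (p : E3) ^ 2 + inner ℝ (b 1) (p : E3) ^ 2 + inner ℝ (b 2) (p : E3) ^ 2 = 1 := by
  rw [sum_sq_inner, norm_eq_of_mem_sphere p, one_pow]

theorem dist_sq_eq_sum (p q : Sph2) :
    dist p q ^ 2 = (inner ℝ (b 0) (p : E3) - inner ℝ (b 0) (q : E3)) ^ 2 +
      (inner ℝ (b 1) (p : E3) - inner ℝ (b 1) (q : E3)) ^ 2 +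
      (inner ℝ (b 2) (p : E3) - inner ℝ (b 2) (q : E3)) ^ 2 := by
  rw [Subtype.dist_eq, dist_eq_norm, ← sum_sq_inner b]
  simp only [inner_sub_right]

theorem eq_of_inner_eq {p q : Sph2} (h0 : inner ℝ (b 0) (p : E3) = inner ℝ (b 0) (q : E3))
    (h1 : inner ℝ (b 1) (p : E3) = inner ℝ (b 1) (q : E3))
    (h2 : inner ℝ (b 2) (p : E3) = inner ℝ (b 2) (q : E3)) : p = q := by
  have h := dist_sq_eq_sum b p q
  rw [h0, h1, h2] at h
  exact dist_eq_zero.mp (pow_eq_zero_iff two_ne_zero |>.mp (by linarith))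

/-- The point of the sphere with latitude `θ` and longitude `φ`. -/
def pt (θ φ : ℝ) : Sph2 :=
  ⟨(Real.cos θ * Real.cos φ) • b 0 + (Real.cos θ * Real.sin φ) • b 1 + Real.sin θ • b 2, by
    rw [mem_sphere_zero_iff_norm, ← sq_eq_sq₀ (norm_nonneg _) zero_le_one, ← sum_sq_inner b]
    simp only [inner_add_right, inner_smul_right, inner_basis]
    simp only [Fin.isValue, Fin.reduceEq, if_true, if_false]
    have h1 := Real.sin_sq_add_cos_sq θ
    have h2 := Real.sin_sq_add_cos_sq φ
    linear_combination h1 + Real.cos θ ^ 2 * h2⟩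

@[simp] theorem inner_zero_pt (θ φ : ℝ) :
    inner ℝ (b 0) (pt b θ φ : E3) = Real.cos θ * Real.cos φ := by
  simp [pt, inner_add_right, inner_smul_right]

@[simp] theorem inner_one_pt (θ φ : ℝ) :
    inner ℝ (b 1) (pt b θ φ : E3) = Real.cos θ * Real.sin φ := by
  simp [pt, inner_add_right, inner_smul_right]

@[simp] theorem inner_two_pt (θ φ : ℝ) : inner ℝ (b 2) (pt b θ φ : E3) = Real.sin θ := by
  simp [pt, inner_add_right, inner_smul_right]

theorem continuous_pt : Continuous fun x : ℝ × ℝ => pt b x.1 x.2 := by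
  unfold pt
  fun_prop

theorem continuousOn_pt {X : Type*} [TopologicalSpace X] {f g : X → ℝ} {s : Set X}
    (hf : ContinuousOn f s) (hg : ContinuousOn g s) : ContinuousOn (fun x => pt b (f x) (g x)) s :=
  Continuous.comp_continuousOn (f := fun x => (f x, g x)) (continuous_pt b) (hf.prodMk hg)

theorem mem_hemi_iff {p : Sph2} : p ∈ hemi b ↔ 0 < inner ℝ (b 0) (p : E3) :=
  Real.arccos_lt_pi_div_two

theorem continuous_lat : Continuous (lat b) := by
  unfold lat
  exact Real.continuous_arcsin.comp (by fun_prop)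

theorem isOpen_hemi : IsOpen (hemi b) := by
  have : hemi b = {p : Sph2 | 0 < inner ℝ (b 0) (p : E3)} := by
    ext p; exact mem_hemi_iff b
  rw [this]
  exact isOpen_lt continuous_const (by fun_prop)

theorem continuousOn_lon : ContinuousOn (lon b) (hemi b) := by
  unfold lon
  refine Real.continuous_arctan.comp_continuousOn (ContinuousOn.div ?_ ?_ ?_)
  · exact Continuous.continuousOn (by fun_prop)
  · exact Continuous.continuousOn (by fun_prop)
  · exact fun p hp => ((mem_hemi_iff b).mp hp).ne'

theorem abs_inner_two_lt_one {p : Sph2} (hp : p ∈ hemi b) :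
    |inner ℝ (b 2) (p : E3)| < 1 := by
  have h := sum_sq_inner_eq_one b p
  have h0 := (mem_hemi_iff b).mp hp
  rw [← sq_lt_one_iff_abs_lt_one]
  nlinarith [sq_nonneg (inner ℝ (b 1) (p : E3)), pow_pos h0 2]

theorem lat_mem_Ioo {p : Sph2} (hp : p ∈ hemi b) : lat b p ∈ Ioo (-(π / 2)) (π / 2) := by
  have h := abs_lt.mp (abs_inner_two_lt_one b hp)
  exact ⟨Real.neg_pi_div_two_lt_arcsin.mpr h.1, Real.arcsin_lt_pi_div_two.mpr h.2⟩

theorem lon_mem_Ioo (p : Sph2) : lon b p ∈ Ioo (-(π / 2)) (π / 2) :=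
  Real.arctan_mem_Ioo _

theorem sin_lat (p : Sph2) : Real.sin (lat b p) = inner ℝ (b 2) (p : E3) := by
  have h := sum_sq_inner_eq_one b p
  have h2 : |inner ℝ (b 2) (p : E3)| ≤ 1 := by
    rw [← sq_le_one_iff_abs_le_one]
    nlinarith [sq_nonneg (inner ℝ (b 1) (p : E3)), sq_nonneg (inner ℝ (b 0) (p : E3))]
  exact Real.sin_arcsin (abs_le.mp h2).1 (abs_le.mp h2).2

theorem lat_lt_lat_iff {p q : Sph2} :
    lat b p < lat b q ↔ inner ℝ (b 2) (p : E3) < inner ℝ (b 2) (q : E3) := by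
  rw [← sin_lat, ← sin_lat]
  exact (Real.strictMonoOn_sin.lt_iff_lt (Real.arcsin_mem_Icc _) (Real.arcsin_mem_Icc _)).symm

theorem lat_eq_lat_iff {p q : Sph2} :
    lat b p = lat b q ↔ inner ℝ (b 2) (p : E3) = inner ℝ (b 2) (q : E3) := by
  rw [← sin_lat, ← sin_lat]
  exact (Real.injOn_sin.eq_iff (Real.arcsin_mem_Icc _) (Real.arcsin_mem_Icc _)).symm

theorem lat_pos_iff {p : Sph2} : 0 < lat b p ↔ 0 < inner ℝ (b 2) (p : E3) :=
  Real.arcsin_pos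

theorem lat_eq_zero_iff {p : Sph2} : lat b p = 0 ↔ inner ℝ (b 2) (p : E3) = 0 :=
  Real.arcsin_eq_zero_iff

theorem pt_mem_hemi {θ φ : ℝ} (hθ : θ ∈ Ioo (-(π / 2)) (π / 2)) (hφ : φ ∈ Ioo (-(π / 2)) (π / 2)) :
    pt b θ φ ∈ hemi b := by
  rw [mem_hemi_iff, inner_zero_pt]
  exact mul_pos (Real.cos_pos_of_mem_Ioo hθ) (Real.cos_pos_of_mem_Ioo hφ)

theorem lat_pt {θ : ℝ} (hθ : θ ∈ Ioo (-(π / 2)) (π / 2)) (φ : ℝ) : lat b (pt b θ φ) = θ := by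
  rw [lat, inner_two_pt, Real.arcsin_sin hθ.1.le hθ.2.le]

theorem lon_pt {θ φ : ℝ} (hθ : θ ∈ Ioo (-(π / 2)) (π / 2)) (hφ : φ ∈ Ioo (-(π / 2)) (π / 2)) :
    lon b (pt b θ φ) = φ := by
  rw [lon, inner_zero_pt, inner_one_pt,
    mul_div_mul_left _ _ (Real.cos_pos_of_mem_Ioo hθ).ne', ← Real.tan_eq_sin_div_cos,
    Real.arctan_tan hφ.1 hφ.2]

theorem pt_lat_lon {p : Sph2} (hp : p ∈ hemi b) : pt b (lat b p) (lon b p) = p := by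
  have h0 := (mem_hemi_iff b).mp hp
  have hs := sum_sq_inner_eq_one b p
  set x := inner ℝ (b 0) (p : E3) with hx
  set y := inner ℝ (b 1) (p : E3) with hy
  set z := inner ℝ (b 2) (p : E3) with hz
  have hpos : 0 < x ^ 2 + y ^ 2 := by positivity
  have hcos : Real.cos (lat b p) = √(x ^ 2 + y ^ 2) := by
    rw [lat, Real.cos_arcsin]; congr 1; rw [← hz]; linarith
  have hsq : √(1 + (y / x) ^ 2) = √(x ^ 2 + y ^ 2) / x := by
    rw [← Real.sqrt_sq h0.le, ← Real.sqrt_div' _ (by positivity), Real.sqrt_sq h0.le]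
    congr 1; field_simp
  have hspos : 0 < √(x ^ 2 + y ^ 2) := Real.sqrt_pos.mpr hpos
  apply eq_of_inner_eq b
  · rw [inner_zero_pt, hcos, lon, Real.cos_arctan, ← hx, ← hy, hsq]; field_simp
  · rw [inner_one_pt, hcos, lon, Real.sin_arctan, ← hx, ← hy, hsq]; field_simp
  · rw [inner_two_pt, sin_lat]

/-- The haversine formula. It compares chords with the norm `√(dθ² + c² dφ²)`, from above in
`dist_pt_le` and from below in `le_dist_pt`. -/
theorem dist_pt_sq (θ φ θ' φ' : ℝ) :
    dist (pt b θ φ) (pt b θ' φ') ^ 2 = (2 * Real.sin ((θ - θ') / 2)) ^ 2 +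
      Real.cos θ * Real.cos θ' * (2 * Real.sin ((φ - φ') / 2)) ^ 2 := by
  have half (x : ℝ) : (2 * Real.sin (x / 2)) ^ 2 = 2 - 2 * Real.cos x := by
    have := Real.cos_sq (x / 2)
    have h1 := Real.sin_sq_add_cos_sq (x / 2)
    rw [show 2 * (x / 2) = x by ring] at this
    linear_combination 4 * h1 - 4 * this
  rw [half, half, Real.cos_sub, Real.cos_sub, dist_sq_eq_sum b]
  simp only [inner_zero_pt, inner_one_pt, inner_two_pt]
  have h1 := Real.sin_sq_add_cos_sq θ
  have h2 := Real.sin_sq_add_cos_sq φ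
  have h3 := Real.sin_sq_add_cos_sq θ'
  have h4 := Real.sin_sq_add_cos_sq φ'
  linear_combination h1 + h3 + Real.cos θ ^ 2 * h2 + Real.cos θ' ^ 2 * h4

theorem dist_pt_le (θ φ θ' φ' c : ℝ)
    (hc : Real.cos θ * Real.cos θ' ≤ c ^ 2) :
    dist (pt b θ φ) (pt b θ' φ') ≤ √((θ - θ') ^ 2 + (c * (φ - φ')) ^ 2) := by
  have half (x : ℝ) : (2 * Real.sin (x / 2)) ^ 2 ≤ x ^ 2 := by
    rw [sq_le_sq, abs_mul, abs_two]
    have := Real.abs_sin_le_abs (x := x / 2)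
    rw [abs_div, abs_two] at this
    linarith
  apply Real.le_sqrt_of_sq_le
  rw [dist_pt_sq, mul_pow c]
  exact add_le_add (half _) (mul_le_mul hc (half _) (sq_nonneg _) (sq_nonneg _))

theorem le_dist_pt {θ φ θ' φ' c k : ℝ} (hk : 0 ≤ k)
    (hθ : k * |θ - θ'| ≤ 2 * |Real.sin ((θ - θ') / 2)|)
    (hφ : k * (c * |φ - φ'|) ≤ √(Real.cos θ * Real.cos θ') * (2 * |Real.sin ((φ - φ') / 2)|))
    (h0 : 0 ≤ Real.cos θ * Real.cos θ') (hc : 0 ≤ c) :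
    k * √((θ - θ') ^ 2 + (c * (φ - φ')) ^ 2) ≤ dist (pt b θ φ) (pt b θ' φ') := by
  apply le_of_sq_le_sq _ dist_nonneg
  rw [dist_pt_sq, mul_pow, Real.sq_sqrt (by positivity)]
  have h1 := pow_le_pow_left₀ (by positivity) hθ 2
  have h2 := pow_le_pow_left₀ (by positivity) hφ 2
  rw [mul_pow √_, Real.sq_sqrt h0] at h2
  simp only [mul_pow, sq_abs] at h1 h2 ⊢
  linarith

end Coordinates

/-! ### Consequences of spherical convexity -/

section Convexity

variable {b : OrthonormalBasis (Fin 3) ℝ E3} {K : Set Sph2}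

/-- The hypotheses of the theorem on Steiner symmetrization. -/
structure Admissible (b : OrthonormalBasis (Fin 3) ℝ E3) (K : Set Sph2) : Prop where
  body : IsSphConvexBody K
  subset_hemi : K ⊆ hemi b
  connected : ConnectednessProperty b K
  monotone : AngularMonotone b K

/-- Two points of an open hemisphere are joined by the normalized affine path between them. -/
theorem exists_path {p q : Sph2} (hp : p ∈ hemi b) (hq : q ∈ hemi b) :
    ∃ γ : ℝ → Sph2, ContinuousOn γ (Icc 0 1) ∧ γ 0 = p ∧ γ 1 = q ∧
      ∀ t ∈ Icc (0 : ℝ) 1, ∃ u v : ℝ, 0 ≤ u ∧ 0 ≤ v ∧ 1 ≤ u + v ∧ (t < 1 → 0 < u) ∧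
        (0 < t → 0 < v) ∧ (γ t : E3) = u • (p : E3) + v • (q : E3) := by
  classical
  set w : ℝ → E3 := fun t => (1 - t) • (p : E3) + t • (q : E3) with hw
  have hwc : Continuous w := by fun_prop
  have hpn : ‖(p : E3)‖ = 1 := norm_eq_of_mem_sphere p
  have hqn : ‖(q : E3)‖ = 1 := norm_eq_of_mem_sphere q
  have hw0 : ∀ t ∈ Icc (0 : ℝ) 1, w t ≠ 0 := by
    intro t ht h
    have h1 : inner ℝ (b 0) (w t) = 0 := by rw [h, inner_zero_right]
    simp only [hw, inner_add_right, inner_smul_right] at h1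
    have hp0 := (mem_hemi_iff b).mp hp
    have hq0 := (mem_hemi_iff b).mp hq
    rcases ht.1.eq_or_lt with rfl | h0
    · simp at h1; linarith
    · have := mul_pos h0 hq0
      have := mul_nonneg (sub_nonneg.mpr ht.2) hp0.le
      linarith
  have hw1 : ∀ t ∈ Icc (0 : ℝ) 1, ‖w t‖ ≤ 1 := by
    intro t ht
    calc ‖w t‖ ≤ ‖(1 - t) • (p : E3)‖ + ‖t • (q : E3)‖ := norm_add_le _ _
      _ = 1 := by
        rw [norm_smul, norm_smul, hpn, hqn, Real.norm_of_nonneg ht.1,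
          Real.norm_of_nonneg (sub_nonneg.mpr ht.2)]
        ring
  let γ : ℝ → Sph2 := fun t => if h : w t ≠ 0 then ⟨‖w t‖⁻¹ • w t, by
    rw [mem_sphere_zero_iff_norm, norm_smul, norm_inv, norm_norm,
      inv_mul_cancel₀ (norm_ne_zero_iff.mpr h)]⟩ else p
  have hγ : ∀ t ∈ Icc (0 : ℝ) 1, (γ t : E3) = ‖w t‖⁻¹ • w t := by
    intro t ht
    simp only [γ, dif_pos (hw0 t ht)]
  refine ⟨γ, ?_, ?_, ?_, ?_⟩
  · rw [Topology.IsInducing.subtypeVal.continuousOn_iff]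
    refine ContinuousOn.congr (f := fun t => ‖w t‖⁻¹ • w t) ?_ hγ
    exact (hwc.norm.continuousOn.inv₀ fun t ht => norm_ne_zero_iff.mpr (hw0 t ht)).smul
      hwc.continuousOn
  · apply Subtype.ext
    rw [hγ 0 (by simp)]
    simp [hw]
  · apply Subtype.ext
    rw [hγ 1 (by simp)]
    simp [hw]
  · intro t ht
    have hpos : 0 < ‖w t‖ := norm_pos_iff.mpr (hw0 t ht)
    -- Normalizing pushes the affine chord outwards, hence coefficients with sum at least `1`.
    have hle : 1 ≤ ‖w t‖⁻¹ := (one_le_inv₀ hpos).mpr (hw1 t ht)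
    refine ⟨‖w t‖⁻¹ * (1 - t), ‖w t‖⁻¹ * t, ?_, ?_, ?_, ?_, ?_, ?_⟩
    · exact mul_nonneg (by positivity) (sub_nonneg.mpr ht.2)
    · exact mul_nonneg (by positivity) ht.1
    · rw [← mul_add]; simpa using hle
    · intro h; exact mul_pos (by positivity) (sub_pos.mpr h)
    · intro h; positivity
    · rw [hγ t ht, hw, smul_add, smul_smul, smul_smul]

theorem exists_mem_sphSegment_lat_eq {p q : Sph2} (hp : p ∈ hemi b) (hq : q ∈ hemi b) {θ : ℝ}
    (hθ : θ ∈ Icc (lat b p) (lat b q)) : ∃ r ∈ sphSegment p q, lat b r = θ := by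
  obtain ⟨γ, hγ, h0, h1, hc⟩ := exists_path hp hq
  have hcont : ContinuousOn (fun t => lat b (γ t)) (Icc 0 1) :=
    (continuous_lat b).comp_continuousOn hγ
  have := intermediate_value_Icc zero_le_one hcont
  simp only [h0, h1] at this
  obtain ⟨t, ht, rfl⟩ := this hθ
  obtain ⟨u, v, hu, hv, -, -, -, h⟩ := hc t ht
  exact ⟨γ t, ⟨u, v, hu, hv, h⟩, rfl⟩

/-- Above the axis `L`, the latitude restricted to a convex set is open to the north. -/
theorem exists_lat_eq_lon_near (hconv : SphConvex K) (hS : K ⊆ hemi b) {p q : Sph2} (hp : p ∈ K)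
    (hq : q ∈ K) (hp0 : 0 ≤ lat b p) (hpq : lat b p < lat b q) {ε : ℝ} (hε : 0 < ε) :
    ∃ δ > 0, ∀ θ ∈ Ico (lat b p) (lat b p + δ), ∃ r ∈ K, lat b r = θ ∧
      |lon b r - lon b p| < ε := by
  obtain ⟨γ, hγ, h0, h1, hc⟩ := exists_path (hS hp) (hS hq)
  have hγK : ∀ t ∈ Icc (0 : ℝ) 1, γ t ∈ K := by
    intro t ht
    obtain ⟨u, v, hu, hv, -, -, -, h⟩ := hc t ht
    exact hconv.2 p hp q hq ⟨u, v, hu, hv, h⟩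
  have hlon : ContinuousOn (fun t => lon b (γ t)) (Icc 0 1) :=
    (continuousOn_lon b).comp hγ fun t ht => hS (hγK t ht)
  have hlat : ContinuousOn (fun t => lat b (γ t)) (Icc 0 1) :=
    (continuous_lat b).comp_continuousOn hγ
  obtain ⟨η, hη, hclose⟩ := Metric.continuousOn_iff.mp hlon 0 (by simp) ε hε
  simp only [h0, Real.dist_eq, sub_zero] at hclose
  set t₀ := min 1 (η / 2) with ht₀
  have ht₀pos : 0 < t₀ := by positivity
  have ht₀1 : t₀ ≤ 1 := min_le_left _ _
  have ht₀η : t₀ < η := (min_le_right _ _).trans_lt (by linarith)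
  -- With heights `0 ≤ z_p < z_q`, a positive weight `v` and `u + v ≥ 1`, the new height exceeds `(u
  -- + v) z_p ≥ z_p`. This is where `p` must not lie south of the axis.
  have hgt : lat b p < lat b (γ t₀) := by
    obtain ⟨u, v, hu, hv, huv, -, hvpos, h⟩ := hc t₀ ⟨ht₀pos.le, ht₀1⟩
    rw [lat_lt_lat_iff] at hpq ⊢
    have hp0' : 0 ≤ inner ℝ (b 2) (p : E3) := Real.arcsin_nonneg.mp hp0
    rw [h, inner_add_right, inner_smul_right, inner_smul_right]
    nlinarith [mul_pos (hvpos ht₀pos) (sub_pos.mpr hpq), mul_nonneg (sub_nonneg.mpr huv) hp0']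
  refine ⟨lat b (γ t₀) - lat b p, sub_pos.mpr hgt, fun θ hθ => ?_⟩
  have hsub : Icc 0 t₀ ⊆ Icc (0 : ℝ) 1 := Icc_subset_Icc_right ht₀1
  have := intermediate_value_Icc ht₀pos.le (hlat.mono hsub)
  simp only [h0] at this
  obtain ⟨t, ht, rfl⟩ := this ⟨hθ.1, by linarith [hθ.2]⟩
  refine ⟨γ t, hγK t (hsub ht), rfl, hclose t (hsub ht) ?_⟩
  rw [abs_of_nonneg ht.1]
  exact ht.2.trans_lt ht₀η

/-- Great-circle arcs bulge towards the pole: the midpoint of two distinct points at the same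
positive latitude is strictly higher. -/
theorem eq_of_lat_eq_max (hconv : SphConvex K) (hS : K ⊆ hemi b) {p q : Sph2} (hp : p ∈ K)
    (hq : q ∈ K) (hmax : ∀ r ∈ K, lat b r ≤ lat b q) (hpos : 0 < lat b q)
    (hpq : lat b p = lat b q) : p = q := by
  obtain ⟨γ, -, -, -, hc⟩ := exists_path (hS hp) (hS hq)
  obtain ⟨u, v, hu, hv, huv, hu1, hv1, h⟩ := hc (1 / 2) (by norm_num)
  have hu0 := hu1 (by norm_num)
  have hv0 := hv1 (by norm_num)
  have hle := hmax _ (hconv.2 p hp q hq ⟨u, v, hu, hv, h⟩)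
  rw [← not_lt, lat_lt_lat_iff, h, inner_add_right, inner_smul_right, inner_smul_right,
    (lat_eq_lat_iff b).mp hpq] at hle
  have hz := (lat_pos_iff b).mp hpos
  have hsum : u + v = 1 := by
    by_contra hne
    have : 1 < u + v := lt_of_le_of_ne huv (Ne.symm hne)
    apply hle
    nlinarith
  have hnorm : ‖(γ (1 / 2) : E3)‖ ^ 2 = 1 := by rw [norm_eq_of_mem_sphere, one_pow]
  rw [h, norm_add_sq_real, norm_smul, norm_smul, norm_eq_of_mem_sphere p,
    norm_eq_of_mem_sphere q, Real.norm_of_nonneg hu, Real.norm_of_nonneg hv, inner_smul_left,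
    inner_smul_right] at hnorm
  simp only [conj_trivial, mul_one] at hnorm
  have h1 : u * v * (inner ℝ (p : E3) (q : E3) - 1) = 0 := by
    have : (u + v) ^ 2 = 1 := by rw [hsum, one_pow]
    linarith
  have h2 : inner ℝ (p : E3) (q : E3) = 1 := by
    rcases mul_eq_zero.mp h1 with h | h
    · exact absurd h (by positivity)
    · linarith
  exact Subtype.ext ((inner_eq_one_iff_of_norm_eq_one (norm_eq_of_mem_sphere p)
    (norm_eq_of_mem_sphere q)).mp h2)

end Convexity

/-! ### Slices by distance curves -/

section Slices

variable (b : OrthonormalBasis (Fin 3) ℝ E3) (K : Set Sph2)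

/-- The greatest longitude of the points of `K` of latitude `θ`. -/
def east (θ : ℝ) : ℝ := sSup (lon b '' (K ∩ distCurve b θ))

/-- The least longitude of the points of `K` of latitude `θ`. -/
def west (θ : ℝ) : ℝ := sInf (lon b '' (K ∩ distCurve b θ))

variable {b K}

theorem mem_slice (hS : K ⊆ hemi b) {p : Sph2} (hp : p ∈ K) : p ∈ K ∩ distCurve b (lat b p) :=
  ⟨hp, hS hp, rfl⟩

theorem isCompact_lon_slice (hK : IsCompact K) (hS : K ⊆ hemi b) (θ : ℝ) :
    IsCompact (lon b '' (K ∩ distCurve b θ)) := by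
  have h : K ∩ distCurve b θ = K ∩ lat b ⁻¹' {θ} := by
    ext p
    exact ⟨fun h => ⟨h.1, h.2.2⟩, fun h => ⟨h.1, hS h.1, h.2⟩⟩
  rw [h]
  exact (hK.inter_right (isClosed_singleton.preimage (continuous_lat b))).image_of_continuousOn
    ((continuousOn_lon b).mono (inter_subset_left.trans hS))

theorem lon_le_east (hK : IsCompact K) (hS : K ⊆ hemi b) {p : Sph2} (hp : p ∈ K) :
    lon b p ≤ east b K (lat b p) :=
  le_csSup (isCompact_lon_slice hK hS _).bddAbove (mem_image_of_mem _ (mem_slice hS hp))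

theorem west_le_lon (hK : IsCompact K) (hS : K ⊆ hemi b) {p : Sph2} (hp : p ∈ K) :
    west b K (lat b p) ≤ lon b p :=
  csInf_le (isCompact_lon_slice hK hS _).bddBelow (mem_image_of_mem _ (mem_slice hS hp))

theorem exists_lon_eq_east (hK : IsCompact K) (hS : K ⊆ hemi b) {p : Sph2} (hp : p ∈ K) :
    ∃ r ∈ K, lat b r = lat b p ∧ lon b r = east b K (lat b p) := by
  obtain ⟨r, hr, h⟩ := (isCompact_lon_slice hK hS (lat b p)).sSup_mem
    ⟨_, mem_image_of_mem _ (mem_slice hS hp)⟩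
  exact ⟨r, hr.1, hr.2.2, h⟩

theorem exists_lon_eq_west (hK : IsCompact K) (hS : K ⊆ hemi b) {p : Sph2} (hp : p ∈ K) :
    ∃ r ∈ K, lat b r = lat b p ∧ lon b r = west b K (lat b p) := by
  obtain ⟨r, hr, h⟩ := (isCompact_lon_slice hK hS (lat b p)).sInf_mem
    ⟨_, mem_image_of_mem _ (mem_slice hS hp)⟩
  exact ⟨r, hr.1, hr.2.2, h⟩

theorem angLength_eq (hK : IsCompact K) (hS : K ⊆ hemi b) (θ : ℝ) :
    angLength b (K ∩ distCurve b θ) = east b K θ - west b K θ :=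
  Real.diam_eq (isCompact_lon_slice hK hS θ).isBounded

theorem exists_lat_eq_of_angLength_pos {θ : ℝ} (h : 0 < angLength b (K ∩ distCurve b θ)) :
    ∃ p ∈ K, lat b p = θ := by
  by_contra! hne
  have : K ∩ distCurve b θ = ∅ := by
    ext p
    simpa using fun hp hp' => hne p hp hp'.2
  simp [this, angLength] at h

/-- Small motions along a distance curve stay in a neighbourhood. -/
theorem eventually_pt_mem {p : Sph2} (hp : p ∈ hemi b) {U : Set Sph2} (hU : U ∈ nhds p) :
    ∀ᶠ x : ℝ × ℝ in nhds (lat b p, lon b p), pt b x.1 x.2 ∈ U := by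
  have := (continuous_pt b).continuousAt (x := (lat b p, lon b p))
  apply this
  simpa only [pt_lat_lon b hp] using hU

/-- An interior point gives a slice of positive width at its own latitude; angular monotonicity
carries this to the equator. -/
theorem angLength_zero_pos (hA : Admissible b K) : 0 < angLength b (K ∩ distCurve b 0) := by
  obtain ⟨p, hp⟩ := hA.body.interior_nonempty
  have hK := hA.body.isCompact
  have hS := hA.subset_hemi
  have hpK := interior_subset hp
  have hlat := lat_mem_Ioo b (hS hpK)
  have hpos : 0 < angLength b (K ∩ distCurve b (lat b p)) := by
    have h1 := eventually_pt_mem (hS hpK) (mem_interior_iff_mem_nhds.mp hp)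
    have h2 : Filter.Tendsto (fun φ : ℝ => (lat b p, φ)) (nhdsWithin (lon b p) (Ioi (lon b p)))
        (nhds (lat b p, lon b p)) :=
      (Continuous.tendsto (by fun_prop) _).mono_left nhdsWithin_le_nhds
    have h3 := (h2.eventually h1).and (Ioo_mem_nhdsGT (lon_mem_Ioo b p).2)
    obtain ⟨φ, hφ, hφ1, hφ2⟩ := h3.exists
    have hlon := lon_pt b hlat ⟨(lon_mem_Ioo b p).1.trans hφ1, hφ2⟩
    have h4 := lon_le_east hK hS hφ
    have h5 := west_le_lon hK hS hpK
    rw [lat_pt b hlat, hlon] at h4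
    rw [angLength_eq hK hS]
    linarith
  have h0 : (0 : ℝ) < π / 2 := by positivity
  rcases le_total 0 (lat b p) with h | h
  · exact hpos.trans_le (hA.monotone.1 ⟨le_rfl, h0⟩ ⟨h, hlat.2⟩ h)
  · exact hpos.trans_le (hA.monotone.2 ⟨hlat.1, h⟩ ⟨by linarith, le_rfl⟩ h)

end Slices

/-! ### Continuity of the extreme longitudes north of the axis -/

section North

open Filter Topology

variable {b : OrthonormalBasis (Fin 3) ℝ E3} {K : Set Sph2} {q : Sph2}

/-- `q` is a point of `K` of greatest latitude, and it lies above the axis `L`. -/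
structure IsTop (b : OrthonormalBasis (Fin 3) ℝ E3) (K : Set Sph2) (q : Sph2) : Prop where
  mem : q ∈ K
  max : ∀ p ∈ K, lat b p ≤ lat b q
  pos : 0 < lat b q

theorem IsTop.lt_pi_div_two (hA : Admissible b K) (hq : IsTop b K q) : lat b q < π / 2 :=
  (lat_mem_Ioo b (hA.subset_hemi hq.mem)).2

theorem IsTop.exists_lat_eq (hA : Admissible b K) (hq : IsTop b K q) {θ : ℝ}
    (hθ : θ ∈ Icc 0 (lat b q)) : ∃ p ∈ K, lat b p = θ := by
  obtain ⟨p, hp, hp0⟩ := exists_lat_eq_of_angLength_pos (angLength_zero_pos hA)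
  obtain ⟨r, hr, h⟩ := exists_mem_sphSegment_lat_eq (hA.subset_hemi hp) (hA.subset_hemi hq.mem)
    (hp0 ▸ hθ)
  exact ⟨r, hA.body.convex.2 p hp q hq.mem hr, h⟩

theorem sub_antitoneOn (hA : Admissible b K) :
    AntitoneOn (fun θ => east b K θ - west b K θ) (Ico 0 (π / 2)) := by
  have h := hA.monotone.1
  simpa only [angLength_eq hA.body.isCompact hA.subset_hemi] using h

/-- Upper semicontinuity, from compactness: the latitudes of the points of `K` with longitude at
least `a` form a closed set. -/
theorem eventually_east_lt (hA : Admissible b K) (hq : IsTop b K q) {θ₀ a : ℝ}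
    (ha : east b K θ₀ < a) : ∀ᶠ θ in 𝓝[Icc 0 (lat b q)] θ₀, east b K θ < a := by
  have hK := hA.body.isCompact
  have hS := hA.subset_hemi
  have hc : IsClosed (lat b '' (K ∩ lon b ⁻¹' Ici a)) := by
    have h1 : IsClosed (K ∩ lon b ⁻¹' Ici a) :=
      ((continuousOn_lon b).mono hS).preimage_isClosed_of_isClosed hK.isClosed isClosed_Ici
    exact ((hK.of_isClosed_subset h1 inter_subset_left).image (continuous_lat b)).isClosed
  have hn : θ₀ ∉ lat b '' (K ∩ lon b ⁻¹' Ici a) := by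
    rintro ⟨p, ⟨hp, hpa⟩, rfl⟩
    exact (ha.trans_le hpa).not_ge (lon_le_east hK hS hp)
  filter_upwards [nhdsWithin_le_nhds (hc.isOpen_compl.mem_nhds hn), self_mem_nhdsWithin]
    with θ hθ hθ'
  obtain ⟨p, hp, rfl⟩ := hq.exists_lat_eq hA hθ'
  obtain ⟨r, hr, hr1, hr2⟩ := exists_lon_eq_east hK hS hp
  by_contra! hle
  exact hθ ⟨r, ⟨hr, by rwa [mem_preimage, hr2]⟩, hr1⟩

theorem eventually_lt_west (hA : Admissible b K) (hq : IsTop b K q) {θ₀ a : ℝ}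
    (ha : a < west b K θ₀) : ∀ᶠ θ in 𝓝[Icc 0 (lat b q)] θ₀, a < west b K θ := by
  have hK := hA.body.isCompact
  have hS := hA.subset_hemi
  have hc : IsClosed (lat b '' (K ∩ lon b ⁻¹' Iic a)) := by
    have h1 : IsClosed (K ∩ lon b ⁻¹' Iic a) :=
      ((continuousOn_lon b).mono hS).preimage_isClosed_of_isClosed hK.isClosed isClosed_Iic
    exact ((hK.of_isClosed_subset h1 inter_subset_left).image (continuous_lat b)).isClosed
  have hn : θ₀ ∉ lat b '' (K ∩ lon b ⁻¹' Iic a) := by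
    rintro ⟨p, ⟨hp, hpa⟩, rfl⟩
    exact ((mem_Iic.mp hpa).trans_lt ha).not_ge (west_le_lon hK hS hp)
  filter_upwards [nhdsWithin_le_nhds (hc.isOpen_compl.mem_nhds hn), self_mem_nhdsWithin]
    with θ hθ hθ'
  obtain ⟨p, hp, rfl⟩ := hq.exists_lat_eq hA hθ'
  obtain ⟨r, hr, hr1, hr2⟩ := exists_lon_eq_west hK hS hp
  by_contra! hle
  exact hθ ⟨r, ⟨hr, by rwa [mem_preimage, hr2]⟩, hr1⟩

/-- Lower semicontinuity, for different reasons on the two sides of `θ₀`. -/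
theorem eventually_lt_east (hA : Admissible b K) (hq : IsTop b K q) {θ₀ a : ℝ}
    (hθ₀ : θ₀ ∈ Icc 0 (lat b q)) (ha : a < east b K θ₀) :
    ∀ᶠ θ in 𝓝[Icc 0 (lat b q)] θ₀, a < east b K θ := by
  have hK := hA.body.isCompact
  have hS := hA.subset_hemi
  have hT := hq.lt_pi_div_two hA
  -- Going south the width does not shrink, and `west` drops by less than `east b K θ₀ - a`, so
  -- `east` stays above `a`.
  have hleft : ∀ᶠ θ in 𝓝[Icc 0 (lat b q)] θ₀, θ ≤ θ₀ → a < east b K θ := by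
    filter_upwards [eventually_lt_west hA hq (sub_lt_self (west b K θ₀) (sub_pos.mpr ha)),
      self_mem_nhdsWithin] with θ h1 h2 h3
    have := sub_antitoneOn hA ⟨h2.1, h2.2.trans_lt hT⟩ ⟨hθ₀.1, hθ₀.2.trans_lt hT⟩ h3
    dsimp only at this
    linarith
  -- Going north, the arc from the easternmost point to `q` stays in `K` and climbs at first; at the
  -- top latitude there is nothing north of `θ₀`.
  have hright : ∀ᶠ θ in 𝓝[Icc 0 (lat b q)] θ₀, θ₀ ≤ θ → a < east b K θ := by
    rcases hθ₀.2.eq_or_lt with h | h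
    · filter_upwards [self_mem_nhdsWithin] with θ h2 h3
      rwa [← le_antisymm h3 (h ▸ h2.2)]
    · obtain ⟨p, hp, hpθ⟩ := hq.exists_lat_eq hA hθ₀
      obtain ⟨r, hr, hr1, hr2⟩ := exists_lon_eq_east hK hS hp
      rw [hpθ] at hr1 hr2
      obtain ⟨δ, hδ, H⟩ := exists_lat_eq_lon_near hA.body.convex hS hr hq.mem (hr1 ▸ hθ₀.1)
        (hr1 ▸ h) (sub_pos.mpr ha)
      filter_upwards [nhdsWithin_le_nhds (Iio_mem_nhds (lt_add_of_pos_right θ₀ hδ))] with θ h1 h2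
      obtain ⟨s, hs, hs1, hs2⟩ := H θ ⟨hr1 ▸ h2, hr1 ▸ h1⟩
      have := lon_le_east hK hS hs
      rw [hs1] at this
      rw [hr2] at hs2
      linarith [(abs_lt.mp hs2).1]
  filter_upwards [hleft, hright] with θ h1 h2
  exact (le_total θ θ₀).elim h1 h2

theorem eventually_west_lt (hA : Admissible b K) (hq : IsTop b K q) {θ₀ a : ℝ}
    (hθ₀ : θ₀ ∈ Icc 0 (lat b q)) (ha : west b K θ₀ < a) :
    ∀ᶠ θ in 𝓝[Icc 0 (lat b q)] θ₀, west b K θ < a := by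
  have hK := hA.body.isCompact
  have hS := hA.subset_hemi
  have hT := hq.lt_pi_div_two hA
  have hleft : ∀ᶠ θ in 𝓝[Icc 0 (lat b q)] θ₀, θ ≤ θ₀ → west b K θ < a := by
    filter_upwards [eventually_east_lt hA hq (lt_add_of_pos_right (east b K θ₀) (sub_pos.mpr ha)),
      self_mem_nhdsWithin] with θ h1 h2 h3
    have := sub_antitoneOn hA ⟨h2.1, h2.2.trans_lt hT⟩ ⟨hθ₀.1, hθ₀.2.trans_lt hT⟩ h3
    dsimp only at this
    linarith
  have hright : ∀ᶠ θ in 𝓝[Icc 0 (lat b q)] θ₀, θ₀ ≤ θ → west b K θ < a := by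
    rcases hθ₀.2.eq_or_lt with h | h
    · filter_upwards [self_mem_nhdsWithin] with θ h2 h3
      rwa [← le_antisymm h3 (h ▸ h2.2)]
    · obtain ⟨p, hp, hpθ⟩ := hq.exists_lat_eq hA hθ₀
      obtain ⟨r, hr, hr1, hr2⟩ := exists_lon_eq_west hK hS hp
      rw [hpθ] at hr1 hr2
      obtain ⟨δ, hδ, H⟩ := exists_lat_eq_lon_near hA.body.convex hS hr hq.mem (hr1 ▸ hθ₀.1)
        (hr1 ▸ h) (sub_pos.mpr ha)
      filter_upwards [nhdsWithin_le_nhds (Iio_mem_nhds (lt_add_of_pos_right θ₀ hδ))] with θ h1 h2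
      obtain ⟨s, hs, hs1, hs2⟩ := H θ ⟨hr1 ▸ h2, hr1 ▸ h1⟩
      have := west_le_lon hK hS hs
      rw [hs1] at this
      rw [hr2] at hs2
      linarith [(abs_lt.mp hs2).2]
  filter_upwards [hleft, hright] with θ h1 h2
  exact (le_total θ θ₀).elim h1 h2

theorem continuousOn_east (hA : Admissible b K) (hq : IsTop b K q) :
    ContinuousOn (east b K) (Icc 0 (lat b q)) := fun _ hθ =>
  tendsto_order.mpr ⟨fun _ ha => eventually_lt_east hA hq hθ ha,
    fun _ ha => eventually_east_lt hA hq ha⟩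

theorem continuousOn_west (hA : Admissible b K) (hq : IsTop b K q) :
    ContinuousOn (west b K) (Icc 0 (lat b q)) := fun _ hθ =>
  tendsto_order.mpr ⟨fun _ ha => eventually_lt_west hA hq ha,
    fun _ ha => eventually_west_lt hA hq hθ ha⟩

theorem eq_of_lat_lon_eq {p r : Sph2} (hp : p ∈ hemi b) (hr : r ∈ hemi b)
    (h1 : lat b p = lat b r) (h2 : lon b p = lon b r) : p = r := by
  rw [← pt_lat_lon b hp, ← pt_lat_lon b hr, h1, h2]

theorem east_top_eq_west_top (hA : Admissible b K) (hq : IsTop b K q) :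
    east b K (lat b q) = west b K (lat b q) := by
  obtain ⟨r, hr, hr1, hr2⟩ := exists_lon_eq_east hA.body.isCompact hA.subset_hemi hq.mem
  obtain ⟨s, hs, hs1, hs2⟩ := exists_lon_eq_west hA.body.isCompact hA.subset_hemi hq.mem
  rw [← hr2, ← hs2, eq_of_lat_eq_max hA.body.convex hA.subset_hemi hr hq.mem hq.max hq.pos hr1,
    eq_of_lat_eq_max hA.body.convex hA.subset_hemi hs hq.mem hq.max hq.pos hs1]

/-- Join the two distinct extreme points on the equator to `q`. If the slice were a single point,
both arcs would pass through it; but arcs from distinct equatorial points of the hemisphere to `q`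
meet only at `q`. -/
theorem west_lt_east (hA : Admissible b K) (hq : IsTop b K q) {θ : ℝ}
    (hθ : θ ∈ Ico 0 (lat b q)) : west b K θ < east b K θ := by
  have hK := hA.body.isCompact
  have hS := hA.subset_hemi
  have hpos := angLength_zero_pos hA
  obtain ⟨p, hp, hp0⟩ := exists_lat_eq_of_angLength_pos hpos
  rw [angLength_eq hK hS] at hpos
  obtain ⟨p₁, hp₁, hlat₁, hlon₁⟩ := exists_lon_eq_east hK hS hp
  obtain ⟨p₂, hp₂, hlat₂, hlon₂⟩ := exists_lon_eq_west hK hS hp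
  rw [hp0] at hlat₁ hlat₂ hlon₁ hlon₂
  obtain ⟨r₁, hr₁, hrθ₁⟩ := exists_mem_sphSegment_lat_eq (hS hp₁) (hS hq.mem)
    (hlat₁.symm ▸ Ico_subset_Icc_self hθ)
  obtain ⟨r₂, hr₂, hrθ₂⟩ := exists_mem_sphSegment_lat_eq (hS hp₂) (hS hq.mem)
    (hlat₂.symm ▸ Ico_subset_Icc_self hθ)
  have hrK₁ := hA.body.convex.2 _ hp₁ _ hq.mem hr₁
  have hrK₂ := hA.body.convex.2 _ hp₂ _ hq.mem hr₂
  obtain ⟨s₁, t₁, hs₁, ht₁, h₁⟩ := hr₁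
  obtain ⟨s₂, t₂, hs₂, ht₂, h₂⟩ := hr₂
  by_contra! hle
  have e₁ := lon_le_east hK hS hrK₁
  have e₂ := lon_le_east hK hS hrK₂
  have w₁ := west_le_lon hK hS hrK₁
  have w₂ := west_le_lon hK hS hrK₂
  rw [hrθ₁] at e₁ w₁
  rw [hrθ₂] at e₂ w₂
  have hr : r₁ = r₂ := eq_of_lat_lon_eq (hS hrK₁) (hS hrK₂) (hrθ₁.trans hrθ₂.symm) (by linarith)
  have hz := (lat_pos_iff b).mp hq.pos
  have hz₁ := (lat_eq_zero_iff b).mp hlat₁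
  have hz₂ := (lat_eq_zero_iff b).mp hlat₂
  have hx₁ := (mem_hemi_iff b).mp (hS hp₁)
  have hx₂ := (mem_hemi_iff b).mp (hS hp₂)
  have key : s₁ • (p₁ : E3) + t₁ • (q : E3) = s₂ • (p₂ : E3) + t₂ • (q : E3) := by
    rw [← h₁, ← h₂, hr]
  have k (i : Fin 3) := congrArg (fun x : E3 => inner ℝ (b i) x) key
  simp only [inner_add_right, inner_smul_right] at k
  have ht : t₁ = t₂ := by
    have := k 2
    rw [hz₁, hz₂] at this
    exact mul_right_cancel₀ hz.ne' (by linarith)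
  subst ht
  have k0 := k 0
  have k1 := k 1
  have hs₁0 : s₁ ≠ 0 := by
    rintro rfl
    rw [zero_smul, zero_add] at h₁
    have hn := norm_eq_of_mem_sphere r₁
    rw [h₁, norm_smul, norm_eq_of_mem_sphere q, mul_one, Real.norm_of_nonneg ht₁] at hn
    rw [hn, one_smul] at h₁
    rw [Subtype.ext h₁] at hrθ₁
    exact hθ.2.ne hrθ₁.symm
  have hs₂0 : s₂ ≠ 0 := by
    rintro rfl
    rw [zero_mul, add_left_inj] at k0
    exact (mul_ne_zero hs₁0 hx₁.ne') k0
  have : lon b p₁ = lon b p₂ := by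
    rw [lon, lon, ← mul_div_mul_left _ _ hs₁0, add_right_cancel k0, add_right_cancel k1,
      mul_div_mul_left _ _ hs₂0]
  linarith

end North

/-! ### Frontiers of the body and of its symmetral -/

section Frontier

open Filter Topology

variable {b : OrthonormalBasis (Fin 3) ℝ E3} {K : Set Sph2} {q : Sph2}

/-- The symmetral is a continuous image of the compact set of triples `(x, y, φ)` with `x, y ∈ K` at
equal latitude and `|φ| ≤ (lon b x - lon b y) / 2`. -/
theorem isCompact_symmetral (hK : IsCompact K) (hS : K ⊆ hemi b) : IsCompact (symmetral b K) := by
  set B : Set (Sph2 × Sph2 × ℝ) := K ×ˢ K ×ˢ Icc (-(π / 2)) (π / 2) with hB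
  have hBc : IsCompact B := hK.prod (hK.prod isCompact_Icc)
  set F : Sph2 × Sph2 × ℝ → ℝ × ℝ := fun x =>
    (lat b x.1 - lat b x.2.1, |x.2.2| - (lon b x.1 - lon b x.2.1) / 2) with hF
  have hFc : ContinuousOn F B := by
    have h1 : ContinuousOn (fun x : Sph2 × Sph2 × ℝ => lon b x.1) B :=
      (continuousOn_lon b).comp continuousOn_fst fun x hx => hS hx.1
    have h2 : ContinuousOn (fun x : Sph2 × Sph2 × ℝ => lon b x.2.1) B :=
      (continuousOn_lon b).comp (Continuous.continuousOn (by fun_prop)) fun x hx => hS hx.2.1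
    have h3 := continuous_lat b
    refine ContinuousOn.prodMk (Continuous.continuousOn (by fun_prop)) ?_
    exact (Continuous.continuousOn (by fun_prop)).sub ((h1.sub h2).div_const 2)
  have hcl : IsClosed (B ∩ F ⁻¹' ({0} ×ˢ Iic 0)) :=
    hFc.preimage_isClosed_of_isClosed hBc.isClosed (isClosed_singleton.prod isClosed_Iic)
  have hG : ContinuousOn (fun x : Sph2 × Sph2 × ℝ => pt b (lat b x.1) x.2.2) univ :=
    continuousOn_pt b ((continuous_lat b).comp continuous_fst).continuousOn
      (Continuous.continuousOn (by fun_prop))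
  convert (hBc.of_isClosed_subset hcl inter_subset_left).image_of_continuousOn
    (hG.mono (subset_univ _))
  ext p
  constructor
  · rintro ⟨hp, ⟨r, hr⟩, hlon⟩
    obtain ⟨x, hx, hx1, hx2⟩ := exists_lon_eq_east hK hS hr.1
    obtain ⟨y, hy, hy1, hy2⟩ := exists_lon_eq_west hK hS hr.1
    rw [hr.2.2] at hx1 hx2 hy1 hy2
    rw [angLength_eq hK hS, ← hx2, ← hy2] at hlon
    refine ⟨(x, y, lon b p), ⟨⟨hx, hy, Ioo_subset_Icc_self (lon_mem_Ioo b p)⟩, ?_⟩, ?_⟩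
    · simp only [hF, mem_preimage, mem_prod, mem_singleton_iff, mem_Iic]
      exact ⟨by linarith, by linarith⟩
    · dsimp only
      rw [hx1, pt_lat_lon b hp]
  · rintro ⟨⟨x, y, φ⟩, ⟨⟨hx, hy, -⟩, h⟩, rfl⟩
    simp only [hF, mem_preimage, mem_prod, mem_singleton_iff, mem_Iic] at h hx hy
    have hxy : lat b x = lat b y := by linarith [h.1]
    have h1 := lon_mem_Ioo b x
    have h2 := lon_mem_Ioo b y
    have hφ := abs_le.mp (show |φ| ≤ (lon b x - lon b y) / 2 by linarith [h.2])
    have hφ' : φ ∈ Ioo (-(π / 2)) (π / 2) := ⟨by linarith [h1.2, h2.1], by linarith [h1.2, h2.1]⟩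
    have hl := lat_mem_Ioo b (hS hx)
    refine ⟨pt_mem_hemi b hl hφ', ?_, ?_⟩
    · rw [lat_pt b hl]
      exact ⟨x, mem_slice hS hx⟩
    · rw [lat_pt b hl, lon_pt b hl hφ', angLength_eq hK hS]
      have h3 := lon_le_east hK hS hx
      have h4 := west_le_lon hK hS hy
      rw [← hxy] at h4
      linarith [h.2]

theorem frontier_symmetral_subset (hK : IsCompact K) (hS : K ⊆ hemi b) :
    frontier (symmetral b K) ⊆ symmetral b K :=
  (isCompact_symmetral hK hS).isClosed.frontier_subset

theorem mem_interior_symmetral {p : Sph2} (hp : p ∈ hemi b) {a : ℝ} (ha : |lon b p| < a)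
    (h : ∀ᶠ θ in 𝓝 (lat b p), 2 * a ≤ angLength b (K ∩ distCurve b θ)) :
    p ∈ interior (symmetral b K) := by
  rw [mem_interior_iff_mem_nhds]
  have h1 := (continuous_lat b).continuousAt.eventually h
  have h2 : ∀ᶠ r in 𝓝 p, |lon b r| < a :=
    ((continuousOn_lon b).continuousAt ((isOpen_hemi b).mem_nhds hp)).abs.eventually_lt
      continuousAt_const ha
  filter_upwards [h1, h2, (isOpen_hemi b).mem_nhds hp] with r hr1 hr2 hr
  have ha0 : 0 < a := (abs_nonneg _).trans_lt ha
  obtain ⟨s, hs, hsr⟩ := exists_lat_eq_of_angLength_pos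
    (show 0 < angLength b (K ∩ distCurve b (lat b r)) by linarith)
  by_cases hsS : s ∈ hemi b
  · exact ⟨hr, ⟨s, hs, hsS, hsr⟩, by linarith⟩
  · refine ⟨hr, ?_, by linarith⟩
    by_contra hne
    rw [not_nonempty_iff_eq_empty] at hne
    simp only [hne, angLength, image_empty, diam_empty] at hr1
    linarith

theorem eventually_lt_angLength_of_isTop (hA : Admissible b K) (hq : IsTop b K q) {θ₀ a : ℝ}
    (hθ₀ : θ₀ ∈ Icc 0 (lat b q)) (ha : a < angLength b (K ∩ distCurve b θ₀)) :
    ∀ᶠ θ in 𝓝[Icc 0 (lat b q)] θ₀, a ≤ angLength b (K ∩ distCurve b θ) := by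
  simp only [angLength_eq hA.body.isCompact hA.subset_hemi] at ha ⊢
  have := ((continuousOn_east hA hq).sub (continuousOn_west hA hq)) θ₀ hθ₀
  exact (this.eventually (lt_mem_nhds ha)).mono fun _ h => le_of_lt h

/-- Strictly below the top, a point with smaller `|lon|` is interior because the width is
continuous. At the top the width is zero. -/
theorem abs_lon_eq_of_mem_frontier_symmetral (hA : Admissible b K) (hq : IsTop b K q) {p : Sph2}
    (hp : p ∈ frontier (symmetral b K)) (hpos : 0 < lat b p) :
    lat b p ∈ Ioc 0 (lat b q) ∧
      |lon b p| = (east b K (lat b p) - west b K (lat b p)) / 2 := by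
  have hK := hA.body.isCompact
  have hS := hA.subset_hemi
  obtain ⟨hpS, ⟨r, hr⟩, hle⟩ := frontier_symmetral_subset hK hS hp
  have hpq : lat b p ≤ lat b q := hr.2.2 ▸ hq.max r hr.1
  refine ⟨⟨hpos, hpq⟩, ?_⟩
  rw [← angLength_eq hK hS]
  rcases hpq.eq_or_lt with h | h
  · rw [h, angLength_eq hK hS, east_top_eq_west_top hA hq, ← h] at hle ⊢
    rw [sub_self, zero_div] at hle ⊢
    exact le_antisymm hle (abs_nonneg _)
  · by_contra hne
    have hlt := lt_of_le_of_ne hle hne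
    obtain ⟨a, ha, ha'⟩ := exists_between hlt
    have := eventually_lt_angLength_of_isTop hA hq (a := 2 * a) ⟨hpos.le, hpq⟩ (by linarith)
    rw [nhdsWithin_eq_nhds.mpr (Icc_mem_nhds hpos h)] at this
    exact hp.2 (mem_interior_symmetral hpS ha this)

/-- If this point were interior, a small move east along its distance curve would stay in `K`. -/
theorem pt_east_mem_frontier (hK : IsCompact K) (hS : K ⊆ hemi b) {p : Sph2} (hp : p ∈ K) :
    pt b (lat b p) (east b K (lat b p)) ∈ frontier K := by
  obtain ⟨r, hr, hr1, hr2⟩ := exists_lon_eq_east hK hS hp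
  rw [← hr2, ← hr1, pt_lat_lon b (hS hr)]
  refine ⟨subset_closure hr, fun hint => ?_⟩
  have h1 := eventually_pt_mem (hS hr) (mem_interior_iff_mem_nhds.mp hint)
  have h2 : Tendsto (fun φ : ℝ => (lat b r, φ)) (𝓝[>] (lon b r)) (𝓝 (lat b r, lon b r)) :=
    (Continuous.tendsto (by fun_prop) _).mono_left nhdsWithin_le_nhds
  obtain ⟨φ, hφ, hφ1, hφ2⟩ :=
    ((h2.eventually h1).and (Ioo_mem_nhdsGT (lon_mem_Ioo b r).2)).exists
  have h4 := lon_le_east hK hS hφ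
  have hl := lat_mem_Ioo b (hS hr)
  rw [lat_pt b hl, lon_pt b hl ⟨(lon_mem_Ioo b r).1.trans hφ1, hφ2⟩, hr1, ← hr2] at h4
  exact h4.not_gt hφ1

theorem pt_west_mem_frontier (hK : IsCompact K) (hS : K ⊆ hemi b) {p : Sph2} (hp : p ∈ K) :
    pt b (lat b p) (west b K (lat b p)) ∈ frontier K := by
  obtain ⟨r, hr, hr1, hr2⟩ := exists_lon_eq_west hK hS hp
  rw [← hr2, ← hr1, pt_lat_lon b (hS hr)]
  refine ⟨subset_closure hr, fun hint => ?_⟩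
  have h1 := eventually_pt_mem (hS hr) (mem_interior_iff_mem_nhds.mp hint)
  have h2 : Tendsto (fun φ : ℝ => (lat b r, φ)) (𝓝[<] (lon b r)) (𝓝 (lat b r, lon b r)) :=
    (Continuous.tendsto (by fun_prop) _).mono_left nhdsWithin_le_nhds
  obtain ⟨φ, hφ, hφ1, hφ2⟩ :=
    ((h2.eventually h1).and (Ioo_mem_nhdsLT (lon_mem_Ioo b r).1)).exists
  have h4 := west_le_lon hK hS hφ
  have hl := lat_mem_Ioo b (hS hr)
  rw [lat_pt b hl, lon_pt b hl ⟨hφ1, hφ2.trans (lon_mem_Ioo b r).2⟩, hr1, ← hr2] at h4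
  exact h4.not_gt hφ2

theorem mem_frontier_of_lat_eq_max (hS : K ⊆ hemi b) {p : Sph2} (hp : p ∈ K)
    (hmax : ∀ r ∈ K, lat b r ≤ lat b p) : p ∈ frontier K := by
  refine ⟨subset_closure hp, fun hint => ?_⟩
  have h1 := eventually_pt_mem (hS hp) (mem_interior_iff_mem_nhds.mp hint)
  have h2 : Tendsto (fun θ : ℝ => (θ, lon b p)) (𝓝[>] (lat b p)) (𝓝 (lat b p, lon b p)) :=
    (Continuous.tendsto (by fun_prop) _).mono_left nhdsWithin_le_nhds
  have hl := lat_mem_Ioo b (hS hp)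
  obtain ⟨θ, hθ, hθ1, hθ2⟩ := ((h2.eventually h1).and (Ioo_mem_nhdsGT hl.2)).exists
  have h4 := hmax _ hθ
  rw [lat_pt b ⟨hl.1.trans hθ1, hθ2⟩] at h4
  exact h4.not_gt hθ1

end Frontier

/-! ### Reflection exchanging north and south -/

section Mirror

variable (b : OrthonormalBasis (Fin 3) ℝ E3) {K : Set Sph2}

/-- The basis `(b 0, b 1, -b 2)`. -/
def mirror : OrthonormalBasis (Fin 3) ℝ E3 := b.map (Submodule.reflection (ℝ ∙ b 2)ᗮ)

@[simp] theorem mirror_zero : mirror b 0 = b 0 := by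
  rw [mirror, OrthonormalBasis.map_apply, Submodule.reflection_eq_self_iff,
    Submodule.mem_orthogonal_singleton_iff_inner_right, inner_basis]
  simp

@[simp] theorem mirror_one : mirror b 1 = b 1 := by
  rw [mirror, OrthonormalBasis.map_apply, Submodule.reflection_eq_self_iff,
    Submodule.mem_orthogonal_singleton_iff_inner_right, inner_basis]
  simp

@[simp] theorem mirror_two : mirror b 2 = -b 2 := by
  rw [mirror, OrthonormalBasis.map_apply, Submodule.reflection_orthogonalComplement_singleton_eq_neg]

@[simp] theorem lat_mirror (p : Sph2) : lat (mirror b) p = -lat b p := by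
  simp [lat, Real.arcsin_neg]

@[simp] theorem lon_mirror : lon (mirror b) = lon b := by
  ext p; simp [lon]

@[simp] theorem hemi_mirror : hemi (mirror b) = hemi b := by
  simp [hemi]

@[simp] theorem distCurve_mirror (θ : ℝ) : distCurve (mirror b) θ = distCurve b (-θ) := by
  ext p; simp [distCurve, neg_eq_iff_eq_neg]

@[simp] theorem angLength_mirror : angLength (mirror b) = angLength b := by
  ext A; simp [angLength]

@[simp] theorem symmetral_mirror : symmetral (mirror b) K = symmetral b K := by
  ext p; simp [symmetral]

variable {b}

theorem Admissible.mirror (hA : Admissible b K) : Admissible (mirror b) K where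
  body := hA.body
  subset_hemi := by simpa using hA.subset_hemi
  connected θ hθ := by
    rw [distCurve_mirror]
    exact hA.connected (-θ) ⟨by linarith [hθ.2], by linarith [hθ.1]⟩
  monotone := by
    simp only [AngularMonotone, distCurve_mirror, angLength_mirror]
    constructor
    · intro x hx y hy hxy
      exact hA.monotone.2 ⟨by linarith [hy.2], by linarith [hy.1]⟩
        ⟨by linarith [hx.2], by linarith [hx.1]⟩ (neg_le_neg hxy)
    · intro x hx y hy hxy
      exact hA.monotone.1 ⟨by linarith [hy.2], by linarith [hy.1]⟩
        ⟨by linarith [hx.2], by linarith [hx.1]⟩ (neg_le_neg hxy)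

end Mirror

/-! ### Length comparison for pairs of graphs -/

section Length

open Filter Topology ENNReal

/-- The triangle inequality for the plane vectors `(a, c u)` and `(a, -c v)`. -/
theorem two_mul_sqrt_le (a c u v : ℝ) :
    2 * √(a ^ 2 + (c * ((u - v) / 2)) ^ 2) ≤
      √(a ^ 2 + (c * u) ^ 2) + √(a ^ 2 + (c * v) ^ 2) := by
  have hA : 0 ≤ a ^ 2 + (c * u) ^ 2 := by positivity
  have hB : 0 ≤ a ^ 2 + (c * v) ^ 2 := by positivity
  have hAB : a ^ 2 - c ^ 2 * (u * v) ≤ √(a ^ 2 + (c * u) ^ 2) * √(a ^ 2 + (c * v) ^ 2) := by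
    rw [← Real.sqrt_mul hA]
    apply Real.le_sqrt_of_sq_le
    nlinarith [sq_nonneg (a * c * (u + v))]
  apply le_of_sq_le_sq _ (by positivity)
  rw [mul_pow, Real.sq_sqrt (by positivity), add_sq, Real.sq_sqrt hA, Real.sq_sqrt hB]
  linarith

/-- Follows from `sin y > y - y³/4` on `(0, 1]`. -/
theorem mul_abs_le_two_mul_abs_sin {κ x : ℝ} (hκ : 0 ≤ κ) (hx : |x| ≤ 1 - κ) :
    κ * |x| ≤ 2 * |Real.sin (x / 2)| := by
  have key : ∀ y : ℝ, 0 ≤ y → y ≤ 1 - κ → κ * y ≤ 2 * Real.sin (y / 2) := by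
    intro y hy hyκ
    rcases hy.eq_or_lt with rfl | hy0
    · simp
    have h := Real.sin_gt_sub_cube (x := y / 2) (by linarith)
    have h2 : y ^ 2 ≤ 1 - κ := by nlinarith
    nlinarith
  have h := key |x| (abs_nonneg x) hx
  have h2 : 2 * Real.sin (|x| / 2) ≤ 2 * |Real.sin (x / 2)| := by
    rcases abs_cases x with ⟨h, -⟩ | ⟨h, -⟩
    · rw [h]; linarith [le_abs_self (Real.sin (x / 2))]
    · rw [h, neg_div, Real.sin_neg]; linarith [neg_abs_le (Real.sin (x / 2))]
  exact h.trans h2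

variable (b : OrthonormalBasis (Fin 3) ℝ E3) {T : ℝ}

/-- Short chords of the graph of a continuous longitude function, in terms of coordinates. -/
theorem exists_chord_bound (hT : T ∈ Ioo 0 (π / 2)) {f : ℝ → ℝ} (hf : ContinuousOn f (Icc 0 T))
    {κ : ℝ} (hκ : κ ∈ Ioo (0 : ℝ) 1) :
    ∃ δ > 0, ∀ x ∈ Icc 0 T, ∀ y ∈ Icc 0 T, |x - y| < δ →
      κ ^ 2 * √((x - y) ^ 2 + (Real.cos x * (f x - f y)) ^ 2) ≤
        dist (pt b x (f x)) (pt b y (f y)) := by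
  have hc : 0 < Real.cos T := Real.cos_pos_of_mem_Ioo ⟨by linarith [hT.1, hT.2], hT.2⟩
  have hκ2 : κ ^ 2 < 1 := by nlinarith [hκ.1, hκ.2]
  obtain ⟨δ, hδ, H⟩ := Metric.uniformContinuousOn_iff.mp
    (isCompact_Icc.uniformContinuousOn_of_continuous hf) (1 - κ) (by linarith [hκ.2])
  -- One factor `κ` pays for replacing sines by their arguments, using the first two bounds. The
  -- other pays for replacing `√(cos x cos y)` by `cos x`: since cosine is 1-Lipschitz, the third
  -- bound gives `κ² cos x ≤ cos y`.
  refine ⟨min δ (min (1 - κ) ((1 - κ ^ 2) * Real.cos T)), ?_, ?_⟩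
  · have := hκ.2
    exact lt_min hδ (lt_min (by linarith) (mul_pos (by linarith) hc))
  intro x hx y hy hxy
  have hxy1 := hxy.trans_le (min_le_left _ _)
  have hxy2 := (hxy.trans_le (min_le_right _ _)).trans_le (min_le_left _ _)
  have hxy3 := (hxy.trans_le (min_le_right _ _)).trans_le (min_le_right _ _)
  have hcos : ∀ z ∈ Icc 0 T, Real.cos T ≤ Real.cos z := fun z hz =>
    Real.cos_le_cos_of_nonneg_of_le_pi hz.1 (by linarith [hT.2, Real.pi_pos]) hz.2
  have hcx := hcos x hx
  have hcy := hcos y hy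
  have hfxy := H x hx y hy (by rwa [Real.dist_eq])
  rw [Real.dist_eq] at hfxy
  have hκ1 : κ ^ 2 ≤ κ := by nlinarith [hκ.1, hκ.2]
  have hcxy : κ ^ 2 * Real.cos x ≤ Real.cos y := by
    have h1 := (abs_le.mp (Real.abs_cos_sub_cos_le x y)).2
    nlinarith
  refine le_dist_pt b (sq_nonneg κ) ?_ ?_ (by nlinarith) (by linarith)
  · exact (mul_le_mul_of_nonneg_right hκ1 (abs_nonneg _)).trans
      (mul_abs_le_two_mul_abs_sin hκ.1.le hxy2.le)
  · have h1 := mul_abs_le_two_mul_abs_sin hκ.1.le hfxy.le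
    have h2 : κ * Real.cos x ≤ √(Real.cos x * Real.cos y) := by
      apply Real.le_sqrt_of_sq_le
      nlinarith
    calc κ ^ 2 * (Real.cos x * |f x - f y|) = (κ * Real.cos x) * (κ * |f x - f y|) := by ring
      _ ≤ _ := mul_le_mul h2 h1 (mul_nonneg hκ.1.le (abs_nonneg _)) (Real.sqrt_nonneg _)

/-- The distance from `γ x` is 1-Lipschitz and maps the open arc onto a set containing `(0, dist (γ
x) (γ y))`. Omitting the endpoints lets consecutive arcs be disjoint. -/
theorem edist_le_hausdorffMeasure_image_Ioo {X : Type*} [MetricSpace X] [MeasurableSpace X]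
    [BorelSpace X] {γ : ℝ → X} {x y : ℝ} (hxy : x ≤ y) (hγ : ContinuousOn γ (Icc x y)) :
    edist (γ x) (γ y) ≤ Measure.hausdorffMeasure 1 (γ '' Ioo x y) := by
  have hL : LipschitzWith 1 fun z => dist (γ x) z := LipschitzWith.dist_right _
  have h1 := hL.hausdorffMeasure_image_le zero_le_one (γ '' Ioo x y)
  have h2 := intermediate_value_Ioo hxy (hL.continuous.comp_continuousOn hγ)
  simp only [Function.comp_apply, dist_self] at h2
  rw [image_image] at h1
  have h3 := (measure_mono (μ := Measure.hausdorffMeasure 1) h2).trans h1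
  rw [hausdorffMeasure_real, Real.volume_Ioo, sub_zero] at h3
  simpa [edist_dist] using h3

/-- On the northern side cosine decreases, so `cos x` dominates the cosine on all of `[x, y]`. -/
theorem ediam_graph_le (hT : T ∈ Ioo 0 (π / 2)) {h : ℝ → ℝ} {x y : ℝ} (hx : 0 ≤ x) (hy : y ≤ T)
    {d : ℝ} (hd : ∀ θ ∈ Icc x y, ∀ θ' ∈ Icc x y, |h θ - h θ'| ≤ |d|) :
    ediam ((fun θ => pt b θ (h θ)) '' Icc x y) ≤
      ENNReal.ofReal √((x - y) ^ 2 + (Real.cos x * d) ^ 2) := by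
  apply Metric.ediam_le
  rintro - ⟨θ, hθ, rfl⟩ - ⟨θ', hθ', rfl⟩
  rw [edist_dist]
  apply ENNReal.ofReal_le_ofReal
  have hpi := Real.pi_pos
  have hc : ∀ z ∈ Icc x y, 0 ≤ Real.cos z ∧ Real.cos z ≤ Real.cos x := fun z hz =>
    ⟨Real.cos_nonneg_of_mem_Icc ⟨by linarith [hz.1], by linarith [hz.2, hT.2]⟩,
      Real.cos_le_cos_of_nonneg_of_le_pi hx (by linarith [hz.2, hT.2]) hz.1⟩
  refine (dist_pt_le b _ _ _ _ (Real.cos x) ?_).trans (Real.sqrt_le_sqrt ?_)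
  · rw [sq]
    exact mul_le_mul (hc θ hθ).2 (hc θ' hθ').2 (hc θ' hθ').1 ((hc θ hθ).1.trans (hc θ hθ).2)
  · rw [mul_pow, mul_pow]
    refine add_le_add ?_ (mul_le_mul_of_nonneg_left ?_ (sq_nonneg _))
    · rw [sq_le_sq]
      rw [abs_sub_comm x y]
      exact (abs_le.mpr ⟨by linarith [hθ.1, hθ'.2], by linarith [hθ.2, hθ'.1]⟩).trans
        (le_abs_self (y - x))
    · rw [sq_le_sq]
      exact hd θ hθ θ' hθ'

theorem measurableSet_graph_Ioo (hT : T ∈ Ioo 0 (π / 2)) {f : ℝ → ℝ}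
    (hf : ContinuousOn f (Icc 0 T)) {x y : ℝ} (hx : 0 ≤ x) (hy : y ≤ T) :
    MeasurableSet ((fun θ => pt b θ (f θ)) '' Ioo x y) := by
  have hc : ContinuousOn (fun θ => pt b θ (f θ)) (Icc x y) :=
    continuousOn_pt b continuousOn_id (hf.mono (Icc_subset_Icc hx hy))
  have hpi := Real.pi_pos
  have hl : ∀ θ ∈ Icc x y, lat b (pt b θ (f θ)) = θ := fun θ hθ =>
    lat_pt b ⟨by linarith [hθ.1], by linarith [hθ.2, hT.2]⟩ _
  have h : (fun θ => pt b θ (f θ)) '' Ioo x y =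
      (fun θ => pt b θ (f θ)) '' Icc x y ∩ lat b ⁻¹' Ioo x y := by
    ext p
    constructor
    · rintro ⟨θ, hθ, rfl⟩
      have hθ' := Ioo_subset_Icc_self hθ
      exact ⟨⟨θ, hθ', rfl⟩, by rwa [mem_preimage, hl θ hθ']⟩
    · rintro ⟨⟨θ, hθ, rfl⟩, hp⟩
      dsimp only at hp
      rw [mem_preimage, hl θ hθ] at hp
      exact ⟨θ, hp, rfl⟩
  rw [h]
  exact (isCompact_Icc.image_of_continuousOn hc).isClosed.measurableSet.inter
    (isOpen_Ioo.preimage (continuous_lat b)).measurableSet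

/-- The union of the graphs over `s` of two longitude functions. -/
def graphPair (f g : ℝ → ℝ) (s : Set ℝ) : Set Sph2 :=
  (fun θ => pt b θ (f θ)) '' s ∪ (fun θ => pt b θ (g θ)) '' s

theorem graphPair_mono (f g : ℝ → ℝ) {s t : Set ℝ} (h : s ⊆ t) :
    graphPair b f g s ⊆ graphPair b f g t :=
  union_subset_union (image_mono h) (image_mono h)

theorem measure_graphPair_Ioo (hT : T ∈ Ioo 0 (π / 2)) {f g : ℝ → ℝ}
    (hg : ContinuousOn g (Icc 0 T))
    (hfI : ∀ θ ∈ Icc 0 T, f θ ∈ Ioo (-(π / 2)) (π / 2))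
    (hgI : ∀ θ ∈ Icc 0 T, g θ ∈ Ioo (-(π / 2)) (π / 2))
    (hgf : ∀ θ ∈ Ico 0 T, g θ < f θ) {x y : ℝ} (hx : 0 ≤ x) (hy : y ≤ T) (μ : Measure Sph2) :
    μ (graphPair b f g (Ioo x y)) =
      μ ((fun θ => pt b θ (f θ)) '' Ioo x y) + μ ((fun θ => pt b θ (g θ)) '' Ioo x y) := by
  refine measure_union ?_ (measurableSet_graph_Ioo b hT hg hx hy)
  rw [Set.disjoint_left]
  rintro - ⟨θ, hθ, rfl⟩ ⟨θ', hθ', h⟩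
  have hpi := Real.pi_pos
  have hI : ∀ z ∈ Ioo x y, z ∈ Icc 0 T ∧ z ∈ Ioo (-(π / 2)) (π / 2) := fun z hz =>
    ⟨⟨by linarith [hz.1], by linarith [hz.2]⟩, by linarith [hz.1], by linarith [hz.2, hT.2]⟩
  have h1 := congrArg (lat b) h
  have h2 := congrArg (lon b) h
  dsimp only at h1 h2
  rw [lat_pt b (hI θ hθ).2, lat_pt b (hI θ' hθ').2] at h1
  subst h1
  rw [lon_pt b (hI θ' hθ).2 (hfI θ' (hI θ' hθ).1), lon_pt b (hI θ' hθ).2 (hgI θ' (hI θ' hθ).1)]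
    at h2
  exact (hgf θ' ⟨by linarith [hθ.1], by linarith [hθ.2]⟩).ne h2

/-- The quantitative core: a uniform partition of `[0, T]` yields a fine cover of the symmetrized
graphs whose total diameter, up to `κ²`, is at most the measure of the original ones. -/
theorem exists_cover_graphPair (hT : T ∈ Ioo 0 (π / 2)) {f g : ℝ → ℝ}
    (hf : ContinuousOn f (Icc 0 T)) (hg : ContinuousOn g (Icc 0 T))
    (hfI : ∀ θ ∈ Icc 0 T, f θ ∈ Ioo (-(π / 2)) (π / 2))
    (hgI : ∀ θ ∈ Icc 0 T, g θ ∈ Ioo (-(π / 2)) (π / 2))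
    (hgf : ∀ θ ∈ Ico 0 T, g θ < f θ) (hmono : AntitoneOn (fun θ => f θ - g θ) (Icc 0 T))
    {κ : ℝ} (hκ : κ ∈ Ioo (0 : ℝ) 1) {ε : ℝ} (hε : 0 < ε) :
    ∃ (N : ℕ) (C : Fin N × Bool → Set Sph2), (∀ i, ediam (C i) ≤ ENNReal.ofReal ε) ∧
      graphPair b (fun θ => (f θ - g θ) / 2) (fun θ => -((f θ - g θ) / 2)) (Ioc 0 T) ⊆ ⋃ i, C i ∧
      ENNReal.ofReal (κ ^ 2) * ∑ i, ediam (C i) ≤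
        Measure.hausdorffMeasure 1 (graphPair b f g (Ioo 0 T)) := by
  obtain ⟨δ₁, hδ₁, H₁⟩ := exists_chord_bound b hT hf hκ
  obtain ⟨δ₂, hδ₂, H₂⟩ := exists_chord_bound b hT hg hκ
  set h : ℝ → ℝ := fun θ => (f θ - g θ) / 2 with hh
  have hhc : ContinuousOn h (Icc 0 T) := (hf.sub hg).div_const 2
  obtain ⟨δ₃, hδ₃, H₃⟩ := Metric.uniformContinuousOn_iff.mp
    (isCompact_Icc.uniformContinuousOn_of_continuous hhc) (ε / 2) (half_pos hε)
  -- The first two bounds serve the chord estimates for `f` and `g`. The last two make both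
  -- coordinate increments at most `ε / 2`, hence each diameter at most `ε`.
  set δ := min (min δ₁ δ₂) (min δ₃ (ε / 2)) with hδ
  have hδpos : 0 < δ := by positivity
  obtain ⟨N, hN⟩ := exists_nat_gt (T / δ)
  have hN0 : (0 : ℝ) < N := (div_pos hT.1 hδpos).trans hN
  have hstep : T / N < δ := by rw [div_lt_iff₀ hN0]; rwa [div_lt_iff₀ hδpos, mul_comm] at hN
  set t : ℕ → ℝ := fun i => T / N * i with ht
  have htm : Monotone t := fun i j hij =>
    mul_le_mul_of_nonneg_left (Nat.cast_le.mpr hij) (div_pos hT.1 hN0).le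
  have ht0 : t 0 = 0 := by simp [ht]
  have htN : t N = T := div_mul_cancel₀ _ hN0.ne'
  have hsub : ∀ i, t i - t (i + 1) = -(T / N) := fun i => by simp only [ht]; push_cast; ring
  have habs : ∀ i, |t i - t (i + 1)| < δ := fun i => by
    rw [hsub, abs_neg, abs_of_pos (div_pos hT.1 hN0)]; exact hstep
  have htI : ∀ i ≤ N, t i ∈ Icc 0 T := fun i hi => ⟨ht0 ▸ htm (Nat.zero_le i), htN ▸ htm hi⟩
  set D : ℕ → ℝ := fun i =>
    √((t i - t (i + 1)) ^ 2 + (Real.cos (t i) * (h (t i) - h (t (i + 1)))) ^ 2) with hD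
  set σ : Bool → ℝ := fun s => if s then 1 else -1 with hσ
  have hσabs : ∀ s, |σ s| = 1 := by intro s; cases s <;> simp [hσ]
  set C : Fin N × Bool → Set Sph2 := fun j =>
    (fun θ => pt b θ (σ j.2 * h θ)) '' Icc (t j.1) (t (j.1 + 1)) with hC
  have hdiam : ∀ j, ediam (C j) ≤ ENNReal.ofReal (D j.1) := by
    intro j
    have h1 := htI j.1 j.1.2.le
    have h2 := htI (j.1 + 1) j.1.2
    refine ediam_graph_le b hT h1.1 h2.2 fun θ hθ θ' hθ' => ?_
    rw [← mul_sub, abs_mul, hσabs, one_mul]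
    -- Monotonicity confines `h` on each subinterval between its end values, so no oscillation
    -- enlarges the diameter.
    have hanti : AntitoneOn h (Icc 0 T) := fun x hx y hy hxy => by
      have := hmono hx hy hxy
      simp only [hh] at this ⊢
      linarith
    have hz : ∀ z ∈ Icc (t j.1) (t (j.1 + 1)), h (t (j.1 + 1)) ≤ h z ∧ h z ≤ h (t j.1) :=
      fun z hz => ⟨hanti ⟨h1.1.trans hz.1, hz.2.trans h2.2⟩ h2 hz.2,
        hanti h1 ⟨h1.1.trans hz.1, hz.2.trans h2.2⟩ hz.1⟩
    have e1 := hz θ hθ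
    have e2 := hz θ' hθ'
    exact (abs_le.mpr ⟨by linarith, by linarith⟩).trans (le_abs_self _)
  have hcont : ∀ u : ℝ → ℝ, ContinuousOn u (Icc 0 T) →
      ContinuousOn (fun θ => pt b θ (u θ)) (Icc 0 T) := fun u hu =>
    continuousOn_pt b continuousOn_id hu
  have hlower : ∀ i < N, ENNReal.ofReal (κ ^ 2) * (2 * ENNReal.ofReal (D i)) ≤
      Measure.hausdorffMeasure 1 (graphPair b f g (Ioo (t i) (t (i + 1)))) := by
    intro i hi
    have h1 := htI i hi.le
    have h2 := htI (i + 1) hi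
    have hle : t i ≤ t (i + 1) := htm (Nat.le_succ i)
    have hd := (habs i).trans_le (min_le_left _ _)
    have c1 := H₁ _ h1 _ h2 (hd.trans_le (min_le_left _ _))
    have c2 := H₂ _ h1 _ h2 (hd.trans_le (min_le_right _ _))
    have hconv := two_mul_sqrt_le (t i - t (i + 1)) (Real.cos (t i)) (f (t i) - f (t (i + 1)))
      (g (t i) - g (t (i + 1)))
    have hDi : D i = √((t i - t (i + 1)) ^ 2 + (Real.cos (t i) *
        ((f (t i) - f (t (i + 1)) - (g (t i) - g (t (i + 1)))) / 2)) ^ 2) := by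
      simp only [hD, hh]
      congr 4
      ring
    rw [← hDi] at hconv
    rw [measure_graphPair_Ioo b hT hg hfI hgI hgf h1.1 h2.2]
    have m1 := edist_le_hausdorffMeasure_image_Ioo hle
      ((hcont f hf).mono (Icc_subset_Icc h1.1 h2.2))
    have m2 := edist_le_hausdorffMeasure_image_Ioo hle
      ((hcont g hg).mono (Icc_subset_Icc h1.1 h2.2))
    refine le_trans ?_ (add_le_add m1 m2)
    have e : ENNReal.ofReal (κ ^ 2) * (2 * ENNReal.ofReal (D i)) =
        ENNReal.ofReal (κ ^ 2 * (2 * D i)) := by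
      rw [ENNReal.ofReal_mul (sq_nonneg κ), ENNReal.ofReal_mul zero_le_two, ENNReal.ofReal_ofNat]
    rw [edist_dist, edist_dist, ← ENNReal.ofReal_add dist_nonneg dist_nonneg, e]
    apply ENNReal.ofReal_le_ofReal
    calc κ ^ 2 * (2 * D i) ≤ κ ^ 2 * _ := mul_le_mul_of_nonneg_left hconv (sq_nonneg κ)
      _ ≤ _ := by rw [mul_add]; exact add_le_add c1 c2
  refine ⟨N, C, fun j => (hdiam j).trans (ENNReal.ofReal_le_ofReal ?_), ?_, ?_⟩
  · have h3 := H₃ _ (htI j.1 j.1.2.le) _ (htI (j.1 + 1) j.1.2)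
      ((habs j.1).trans_le ((min_le_right _ _).trans (min_le_left _ _)))
    have h4 := (habs j.1).trans_le ((min_le_right _ _).trans (min_le_right _ _))
    rw [Real.dist_eq] at h3
    apply Real.sqrt_le_iff.mpr ⟨hε.le, ?_⟩
    have h5 : (Real.cos (t j.1) * (h (t j.1) - h (t (j.1 + 1)))) ^ 2 ≤ (ε / 2) ^ 2 := by
      rw [sq_le_sq, abs_mul, abs_of_pos (half_pos hε)]
      exact (mul_le_of_le_one_left (abs_nonneg _) (Real.abs_cos_le_one _)).trans h3.le
    have h6 : (t j.1 - t (j.1 + 1)) ^ 2 ≤ (ε / 2) ^ 2 := by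
      rw [sq_le_sq, abs_of_pos (half_pos hε)]
      exact h4.le
    nlinarith
  · have hcov : ∀ θ ∈ Ioc 0 T, ∃ i : Fin N, θ ∈ Icc (t i) (t (i + 1)) := by
      intro θ hθ
      rw [← ht0, ← htN, ← htm.biUnion_Ico_Ioc_map_succ] at hθ
      simp only [mem_iUnion] at hθ
      obtain ⟨i, hi, hθi⟩ := hθ
      exact ⟨⟨i, hi.2⟩, Ioc_subset_Icc_self hθi⟩
    rintro p (⟨θ, hθ, rfl⟩ | ⟨θ, hθ, rfl⟩) <;> obtain ⟨i, hi⟩ := hcov θ hθ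
    · exact mem_iUnion.mpr ⟨(i, true), θ, hi, by simp [hσ]⟩
    · exact mem_iUnion.mpr ⟨(i, false), θ, hi, by simp [hσ, hh]⟩
  · have hmeas : ∀ i ∈ Finset.range N, MeasurableSet (graphPair b f g (Ioo (t i) (t (i + 1)))) :=
      fun i hi => by
        have h1 := htI i (Finset.mem_range.mp hi).le
        have h2 := htI (i + 1) (Finset.mem_range.mp hi)
        exact (measurableSet_graph_Ioo b hT hf h1.1 h2.2).union
          (measurableSet_graph_Ioo b hT hg h1.1 h2.2)
    -- The pieces lie in disjoint latitude bands, so their measures add.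
    have hlat : ∀ i ∈ Finset.range N,
        graphPair b f g (Ioo (t i) (t (i + 1))) ⊆ lat b ⁻¹' Ioo (t i) (t (i + 1)) := by
      intro i hi
      have h1 := htI i (Finset.mem_range.mp hi).le
      have h2 := htI (i + 1) (Finset.mem_range.mp hi)
      have hpi := Real.pi_pos
      rintro p (⟨θ, hθ, rfl⟩ | ⟨θ, hθ, rfl⟩) <;> rw [mem_preimage, lat_pt] <;>
        first | exact hθ | exact ⟨by linarith [hθ.1, h1.1], by linarith [hθ.2, h2.2, hT.2]⟩
    have hdisj : (Finset.range N : Set ℕ).PairwiseDisjoint fun i =>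
        graphPair b f g (Ioo (t i) (t (i + 1))) := fun i hi j hj hij =>
      ((htm.pairwise_disjoint_on_Ioo_succ hij).preimage (lat b)).mono (hlat i hi) (hlat j hj)
    calc ENNReal.ofReal (κ ^ 2) * ∑ j, ediam (C j)
        ≤ ENNReal.ofReal (κ ^ 2) * ∑ j : Fin N × Bool, ENNReal.ofReal (D j.1) := by
          gcongr with j
          exact hdiam j
      _ = ∑ i ∈ Finset.range N, ENNReal.ofReal (κ ^ 2) * (2 * ENNReal.ofReal (D i)) := by
          rw [Fintype.sum_prod_type, Finset.mul_sum, Finset.sum_range]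
          simp [two_mul]
      _ ≤ ∑ i ∈ Finset.range N,
            Measure.hausdorffMeasure 1 (graphPair b f g (Ioo (t i) (t (i + 1)))) :=
          Finset.sum_le_sum fun i hi => hlower i (Finset.mem_range.mp hi)
      _ = Measure.hausdorffMeasure 1
            (⋃ i ∈ Finset.range N, graphPair b f g (Ioo (t i) (t (i + 1)))) :=
          (measure_biUnion_finset hdisj hmeas).symm
      _ ≤ _ := by
          refine measure_mono (iUnion₂_subset fun i hi => graphPair_mono b f g ?_)
          exact Ioo_subset_Ioo (htI i (Finset.mem_range.mp hi).le).1
            (htI (i + 1) (Finset.mem_range.mp hi)).2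

/-- Symmetrizing a strip bounded by two graphs does not increase the length of its boundary,
provided that the width of the strip is nonincreasing. -/
theorem hausdorffMeasure_graphPair_half_sub_le (hT : T ∈ Ioo 0 (π / 2)) {f g : ℝ → ℝ}
    (hf : ContinuousOn f (Icc 0 T)) (hg : ContinuousOn g (Icc 0 T))
    (hfI : ∀ θ ∈ Icc 0 T, f θ ∈ Ioo (-(π / 2)) (π / 2))
    (hgI : ∀ θ ∈ Icc 0 T, g θ ∈ Ioo (-(π / 2)) (π / 2))
    (hgf : ∀ θ ∈ Ico 0 T, g θ < f θ) (hmono : AntitoneOn (fun θ => f θ - g θ) (Icc 0 T)) :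
    Measure.hausdorffMeasure 1
        (graphPair b (fun θ => (f θ - g θ) / 2) (fun θ => -((f θ - g θ) / 2)) (Ioc 0 T)) ≤
      Measure.hausdorffMeasure 1 (graphPair b f g (Ioo 0 T)) := by
  set S := graphPair b (fun θ => (f θ - g θ) / 2) (fun θ => -((f θ - g θ) / 2)) (Ioc 0 T) with hS
  set M := Measure.hausdorffMeasure 1 (graphPair b f g (Ioo 0 T)) with hM
  have key : ∀ κ ∈ Ioo (0 : ℝ) 1, ENNReal.ofReal (κ ^ 2) * Measure.hausdorffMeasure 1 S ≤ M := by
    intro κ hκ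
    choose N C h1 h2 h3 using fun m : ℕ =>
      exists_cover_graphPair b hT hf hg hfI hgI hgf hmono hκ (Nat.one_div_pos_of_nat (α := ℝ) (n := m))
    have hr : Tendsto (fun m : ℕ => ENNReal.ofReal (1 / ((m : ℝ) + 1))) atTop (𝓝 0) := by
      simpa using ENNReal.tendsto_ofReal tendsto_one_div_add_atTop_nhds_zero_nat
    have hle := Measure.hausdorffMeasure_le_liminf_sum 1 S _ hr C
      (Eventually.of_forall h1) (Eventually.of_forall h2)
    simp only [ENNReal.rpow_one] at hle
    have hκ0 : ENNReal.ofReal (κ ^ 2) ≠ 0 := by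
      simpa using hκ.1.ne'
    -- The bound on the cover sums does not depend on the mesh `1 / (m + 1)`, so it passes to the
    -- lower limit.
    have hbound : liminf (fun m => ∑ i, ediam (C m i)) atTop ≤ (ENNReal.ofReal (κ ^ 2))⁻¹ * M := by
      refine liminf_le_of_le (by isBoundedDefault) fun a ha => ?_
      obtain ⟨m, hm⟩ := ha.exists
      refine hm.trans ?_
      rw [mul_comm, ← div_eq_mul_inv,
        ENNReal.le_div_iff_mul_le (Or.inl hκ0) (Or.inl ENNReal.ofReal_ne_top), mul_comm]
      exact h3 m
    have := hle.trans hbound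
    rwa [mul_comm, ← div_eq_mul_inv,
      ENNReal.le_div_iff_mul_le (Or.inl hκ0) (Or.inl ENNReal.ofReal_ne_top), mul_comm] at this
  have hlim : Tendsto (fun κ : ℝ => ENNReal.ofReal (κ ^ 2) * Measure.hausdorffMeasure 1 S)
      (𝓝[<] 1) (𝓝 (ENNReal.ofReal (1 ^ 2) * Measure.hausdorffMeasure 1 S)) := by
    refine ENNReal.Tendsto.mul_const (ENNReal.tendsto_ofReal ?_) (Or.inl (by simp))
    exact (Continuous.tendsto (by fun_prop) _).mono_left nhdsWithin_le_nhds
  rw [one_pow, ENNReal.ofReal_one, one_mul] at hlim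
  exact le_of_tendsto hlim (by filter_upwards [Ioo_mem_nhdsLT zero_lt_one] using key)

end Length

/-! ### Assembling north, south and equator -/

section Perimeter

open Filter Topology

variable {b : OrthonormalBasis (Fin 3) ℝ E3} {K : Set Sph2}

theorem exists_lat_max (hA : Admissible b K) : ∃ q ∈ K, ∀ p ∈ K, lat b p ≤ lat b q :=
  hA.body.isCompact.exists_isMaxOn (hA.body.interior_nonempty.mono interior_subset)
    (continuous_lat b).continuousOn

theorem hausdorffMeasure_frontier_symmetral_north_le (hA : Admissible b K) :
    Measure.hausdorffMeasure 1 (frontier (symmetral b K) ∩ {p | 0 < lat b p}) ≤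
      Measure.hausdorffMeasure 1 (frontier K ∩ {p | 0 < lat b p}) := by
  have hK := hA.body.isCompact
  have hS := hA.subset_hemi
  obtain ⟨q, hqK, hmax⟩ := exists_lat_max hA
  rcases le_or_gt (lat b q) 0 with h0 | h0
  · have : frontier (symmetral b K) ∩ {p | 0 < lat b p} = ∅ := by
      ext p
      simp only [mem_inter_iff, mem_ofPred_eq, mem_empty_iff_false, iff_false, not_and, not_lt]
      intro hp
      obtain ⟨-, ⟨r, hr⟩, -⟩ := frontier_symmetral_subset hK hS hp
      exact hr.2.2 ▸ (hmax r hr.1).trans h0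
    rw [this, measure_empty]
    exact zero_le
  have hq : IsTop b K q := ⟨hqK, hmax, h0⟩
  have hT := hq.lt_pi_div_two hA
  have heast : ∀ θ ∈ Icc 0 (lat b q), east b K θ ∈ Ioo (-(π / 2)) (π / 2) := by
    intro θ hθ
    obtain ⟨p, hp, rfl⟩ := hq.exists_lat_eq hA hθ
    obtain ⟨r, -, -, hr⟩ := exists_lon_eq_east hK hS hp
    exact hr ▸ lon_mem_Ioo b r
  have hwest : ∀ θ ∈ Icc 0 (lat b q), west b K θ ∈ Ioo (-(π / 2)) (π / 2) := by
    intro θ hθ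
    obtain ⟨p, hp, rfl⟩ := hq.exists_lat_eq hA hθ
    obtain ⟨r, -, -, hr⟩ := exists_lon_eq_west hK hS hp
    exact hr ▸ lon_mem_Ioo b r
  have hle := hausdorffMeasure_graphPair_half_sub_le b ⟨h0, hT⟩ (continuousOn_east hA hq)
    (continuousOn_west hA hq) heast hwest (fun θ hθ => west_lt_east hA hq hθ)
    ((sub_antitoneOn hA).mono fun θ hθ => ⟨hθ.1, hθ.2.trans_lt hT⟩)
  refine (measure_mono ?_).trans (hle.trans (measure_mono ?_))
  · rintro p ⟨hp, hpos⟩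
    obtain ⟨hlat, hlon⟩ := abs_lon_eq_of_mem_frontier_symmetral hA hq hp hpos
    have hpS := (frontier_symmetral_subset hK hS hp).1
    rcases eq_or_eq_neg_of_abs_eq hlon with h | h
    · exact Or.inl ⟨_, hlat, by dsimp only; rw [← h, pt_lat_lon b hpS]⟩
    · exact Or.inr ⟨_, hlat, by dsimp only; rw [← h, pt_lat_lon b hpS]⟩
  · rintro - (⟨θ, hθ, rfl⟩ | ⟨θ, hθ, rfl⟩) <;>
      obtain ⟨p, hp, rfl⟩ := hq.exists_lat_eq hA (Ioo_subset_Icc_self hθ) <;>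
      refine ⟨?_, ?_⟩
    · exact pt_east_mem_frontier hK hS hp
    · rw [mem_ofPred_eq, lat_pt b (lat_mem_Ioo b (hS hp))]
      exact hθ.1
    · exact pt_west_mem_frontier hK hS hp
    · rw [mem_ofPred_eq, lat_pt b (lat_mem_Ioo b (hS hp))]
      exact hθ.1

/-- The connectedness property enters here: a slice fills the whole interval between its extreme
longitudes. -/
theorem exists_lon_eq (hA : Admissible b K) {p : Sph2} (hp : p ∈ K) {φ : ℝ}
    (hφ : φ ∈ Icc (west b K (lat b p)) (east b K (lat b p))) :
    ∃ r ∈ K, lat b r = lat b p ∧ lon b r = φ := by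
  obtain ⟨x, hx, hx1, hx2⟩ := exists_lon_eq_east hA.body.isCompact hA.subset_hemi hp
  obtain ⟨y, hy, hy1, hy2⟩ := exists_lon_eq_west hA.body.isCompact hA.subset_hemi hp
  have hconn := (hA.connected (lat b p) (lat_mem_Ioo b (hA.subset_hemi hp))).image (lon b)
    ((continuousOn_lon b).mono fun r hr => hr.2.1)
  obtain ⟨r, hr, hrφ⟩ := hconn.ordConnected.out
    (mem_image_of_mem _ (hy1 ▸ mem_slice hA.subset_hemi hy))
    (mem_image_of_mem _ (hx1 ▸ mem_slice hA.subset_hemi hx)) (hy2.symm ▸ hx2.symm ▸ hφ)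
  exact ⟨r, hr.1, hr.2.2, hrφ⟩

/-- When `K` does not cross the axis northwards, its whole equatorial slice is frontier. Translating
longitudes on the equator by the midpoint `c` is an isometry carrying this slice onto a set
containing that of the symmetral. -/
theorem hausdorffMeasure_frontier_symmetral_equator_le_of_lat_nonpos (hA : Admissible b K)
    (hmax : ∀ p ∈ K, lat b p ≤ 0) :
    Measure.hausdorffMeasure 1 (frontier (symmetral b K) ∩ {p | lat b p = 0}) ≤
      Measure.hausdorffMeasure 1 (frontier K ∩ {p | lat b p = 0}) := by
  have hK := hA.body.isCompact
  have hS := hA.subset_hemi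
  set c := (east b K 0 + west b K 0) / 2 with hc
  have hL : LipschitzOnWith 1 (fun p => pt b 0 (lon b p - c)) (K ∩ {p | lat b p = 0}) := by
    refine LipschitzOnWith.of_dist_le_mul fun p hp r hr => ?_
    rw [NNReal.coe_one, one_mul]
    apply le_of_sq_le_sq _ dist_nonneg
    have h := dist_pt_sq b (lat b p) (lon b p) (lat b r) (lon b r)
    rw [pt_lat_lon b (hS hp.1), pt_lat_lon b (hS hr.1), hp.2, hr.2] at h
    rw [h, dist_pt_sq, sub_sub_sub_cancel_right]
  have h1 := hL.hausdorffMeasure_image_le zero_le_one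
  rw [ENNReal.coe_one, ENNReal.one_rpow, one_mul] at h1
  refine (measure_mono ?_).trans (h1.trans (measure_mono ?_))
  · rintro p ⟨hp, hp0⟩
    rw [mem_ofPred_eq] at hp0
    obtain ⟨hpS, ⟨s, hs⟩, hlon⟩ := frontier_symmetral_subset hK hS hp
    rw [hp0, angLength_eq hK hS] at hlon
    rw [hp0] at hs
    have hlon' := abs_le.mp hlon
    obtain ⟨r, hr, hr1, hr2⟩ := exists_lon_eq hA hs.1 (φ := lon b p + c) (by
      rw [hs.2.2]; constructor <;> linarith)
    refine ⟨r, ⟨hr, hr1.trans hs.2.2⟩, ?_⟩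
    dsimp only
    rw [hr2, add_sub_cancel_right, ← hp0, pt_lat_lon b hpS]
  · rintro p ⟨hp, hp0⟩
    exact ⟨mem_frontier_of_lat_eq_max hS hp fun r hr => (hmax r hr).trans_eq hp0.symm, hp0⟩

/-- When `K` has points on both sides of the axis, the frontier of the symmetral meets the equator
in at most two points, a null set. -/
theorem hausdorffMeasure_frontier_symmetral_equator_le (hA : Admissible b K) :
    Measure.hausdorffMeasure 1 (frontier (symmetral b K) ∩ {p | lat b p = 0}) ≤
      Measure.hausdorffMeasure 1 (frontier K ∩ {p | lat b p = 0}) := by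
  have hK := hA.body.isCompact
  have hS := hA.subset_hemi
  have hM := hA.mirror
  obtain ⟨q, hqK, hmax⟩ := exists_lat_max hA
  obtain ⟨r, hrK, hrmax⟩ := exists_lat_max hM
  rcases le_or_gt (lat b q) 0 with hq | hq
  · exact hausdorffMeasure_frontier_symmetral_equator_le_of_lat_nonpos hA
      fun p hp => (hmax p hp).trans hq
  rcases le_or_gt (lat (mirror b) r) 0 with hr | hr
  · have := hausdorffMeasure_frontier_symmetral_equator_le_of_lat_nonpos hM
      fun p hp => (hrmax p hp).trans hr
    simpa using this
  have hqT : IsTop b K q := ⟨hqK, hmax, hq⟩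
  have hrT : IsTop (mirror b) K r := ⟨hrK, hrmax, hr⟩
  set l := angLength b (K ∩ distCurve b 0) with hl
  have hsub : frontier (symmetral b K) ∩ {p | lat b p = 0} ⊆
      {pt b 0 (l / 2), pt b 0 (-(l / 2))} := by
    rintro p ⟨hp, hp0⟩
    rw [mem_ofPred_eq] at hp0
    obtain ⟨hpS, -, hlon⟩ := frontier_symmetral_subset hK hS hp
    rw [hp0] at hlon
    have heq : |lon b p| = l / 2 := by
      by_contra hne
      obtain ⟨a, ha, ha'⟩ := exists_between (lt_of_le_of_ne hlon hne)
      refine hp.2 (mem_interior_symmetral hpS ha ?_)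
      -- Continuity of the width is known from the north for `b` and for `mirror b`; together these
      -- give a two-sided neighbourhood of latitude `0`.
      have e1 := eventually_lt_angLength_of_isTop hA hqT (θ₀ := 0) (a := 2 * a) ⟨le_rfl, hq.le⟩
        (by linarith)
      have e2 := eventually_lt_angLength_of_isTop hM hrT (θ₀ := 0) (a := 2 * a) ⟨le_rfl, hr.le⟩
        (by rw [angLength_mirror, distCurve_mirror, neg_zero]; linarith)
      rw [nhdsWithin_Icc_eq_nhdsGE hq, eventually_nhdsWithin_iff] at e1
      rw [nhdsWithin_Icc_eq_nhdsGE hr, eventually_nhdsWithin_iff] at e2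
      have e3 := (continuous_neg.tendsto' (0 : ℝ) 0 neg_zero).eventually e2
      rw [hp0]
      filter_upwards [e1, e3] with θ h1 h3
      rcases le_total 0 θ with h | h
      · exact h1 h
      · simpa using h3 (neg_nonneg.mpr h)
    rcases eq_or_eq_neg_of_abs_eq heq with h | h
    · exact Or.inl (by rw [← h, ← hp0, pt_lat_lon b hpS])
    · exact Or.inr (by rw [mem_singleton_iff, ← h, ← hp0, pt_lat_lon b hpS])
  have := Measure.nullSingletonClass_hausdorff Sph2 zero_lt_one
  rw [((toFinite _).subset hsub).measure_zero]
  exact zero_le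

theorem measure_eq_add_lat (μ : Measure Sph2) (A : Set Sph2) :
    μ A = μ (A ∩ {p | 0 < lat b p}) + (μ (A ∩ {p | lat b p < 0}) + μ (A ∩ {p | lat b p = 0})) := by
  have h1 : MeasurableSet {p : Sph2 | 0 < lat b p} :=
    (isOpen_lt continuous_const (continuous_lat b)).measurableSet
  have h2 : MeasurableSet {p : Sph2 | lat b p < 0} :=
    (isOpen_lt (continuous_lat b) continuous_const).measurableSet
  rw [← measure_inter_add_sdiff A h1, ← measure_inter_add_sdiff (A \ _) h2]
  congr 3 <;> ext p <;>
    simp only [mem_inter_iff, Set.mem_sdiff, mem_ofPred_eq] <;> grind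

theorem perim_symmetral_le (hA : Admissible b K) : perim (symmetral b K) ≤ perim K := by
  unfold perim
  rw [measure_eq_add_lat (b := b) _ (frontier (symmetral b K)),
    measure_eq_add_lat (b := b) _ (frontier K)]
  have h := hausdorffMeasure_frontier_symmetral_north_le hA.mirror
  simp only [symmetral_mirror, lat_mirror, Left.neg_pos_iff] at h
  exact add_le_add (hausdorffMeasure_frontier_symmetral_north_le hA)
    (add_le_add h (hausdorffMeasure_frontier_symmetral_equator_le hA))

end Perimeter

end SphSteiner

end

theorem mainTheorem7 (b : OrthonormalBasis (Fin 3) ℝ SphSteiner.E3) (K : Set SphSteiner.Sph2)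
    (hK : SphSteiner.IsSphConvexBody K) (hKS : K ⊆ SphSteiner.hemi b)
    (hconn : SphSteiner.ConnectednessProperty b K) (hmono : SphSteiner.AngularMonotone b K) :
    SphSteiner.perim (SphSteiner.symmetral b K) ≤ SphSteiner.perim K :=
  SphSteiner.perim_symmetral_le ⟨hK, hKS, hconn, hmono⟩
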